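/- Let $\Lambda$ be the set of finite lattice paths in the first quadrant of $\mathbb Z^2$ that start on the $y$-axis, end on the $x$-axis and take only unit steps to the right or downward. For $\gamma\in\Lambda$ let $|\gamma|$ be its number of steps and $\mathcal A(\gamma)$ the area enclosed by $\gamma$ and the two coordinate axes. Fix $0<\lambda<\frac12$, let $\mathbb P_\lambda$ be the probability measure on $\Lambda$ with $\mathbb P_\lambda[\gamma]=(1-2\lambda)\lambda^{|\gamma|}$, and for $N\in\mathbb N$ let $\mathbb P_\lambda^{N^2}:=\mathbb P_\lambda[\,\cdot\mid \mathcal A(\Gamma)\ge N^2]$, where $\Gamma$ denotes the random path. Let $\mathsf{Ext}(\gamma)$ be the set of non-zero extremal points of the convex hull of $\gamma\cup\{(0,0)\}$, where $\gamma$ is identified with the set of lattice points it visits; the facets of $\gamma$ are the segments joining consecutive points of $\mathsf{Ext}(\gamma)$ (consecutive from left to right and from top to bottom). Let $\mathsf{MeanFL}(\gamma)$ be the Euclidean length of the facet that intersects the line $\{y=x\}$ (the leftmost one if there are two). Then there exist constants $\tilde c,c,C>0$, depending only on $\lambda$, such that for every $N\in\mathbb N$ and every real $t$ with $\tilde c\le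 t\le N^{2/3}$, $$\mathbb P_\lambda^{N^2}\big[\mathsf{MeanFL}(\Gamma)\ge t N^{2/3}\big]\le C\,e^{-c\,t^{3/2}}.$$ -/

import Mathlib

open MeasureTheory ProbabilityTheory

noncomputable section

/-- An oriented path of the first quadrant that starts on the `y`-axis, ends on the `x`-axis and
only takes unit steps to the right (`true`) or down (`false`). Such a path is determined by its
sequence of steps, and every finite sequence of steps occurs: the starting point is
`(0, number of down steps)`, the end point is `(number of right steps, 0)`. -/
structure OrientedPath where
  /-- The successive steps, `true` for right and `false` for down. -/
  steps : List Bool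

namespace OrientedPath

/-- The length `|γ|`, i.e. the number of steps. -/
def length (γ : OrientedPath) : ℕ := γ.steps.length

/-- The `x`-coordinate of `γ(k)`: the number of right steps already taken. -/
def xCoord (γ : OrientedPath) (k : ℕ) : ℕ := (γ.steps.take k).count true

/-- The `y`-coordinate of `γ(k)`: the number of down steps still to be taken. -/
def yCoord (γ : OrientedPath) (k : ℕ) : ℕ := (γ.steps.drop k).count false

theorem xCoord_zero (γ : OrientedPath) : γ.xCoord 0 = 0 := by simp [xCoord]

theorem yCoord_length (γ : OrientedPath) : γ.yCoord γ.length = 0 := by simp [yCoord, length]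

/-- Each step goes either one unit to the right or one unit down. -/
theorem step_right_or_down (γ : OrientedPath) (k : ℕ) (hk : k < γ.length) :
    (γ.xCoord (k + 1) = γ.xCoord k + 1 ∧ γ.yCoord (k + 1) = γ.yCoord k) ∨
      (γ.xCoord (k + 1) = γ.xCoord k ∧ γ.yCoord k = γ.yCoord (k + 1) + 1) := by
  unfold length at hk
  unfold xCoord yCoord
  rw [List.drop_eq_getElem_cons hk, List.take_succ_eq_append_getElem hk]
  cases γ.steps[k] <;> simp

/-- The point `γ(k)` in the Euclidean plane, for `0 ≤ k ≤ |γ|`. -/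
def vertex (γ : OrientedPath) (k : ℕ) : EuclideanSpace ℝ (Fin 2) :=
  !₂[(γ.xCoord k : ℝ), (γ.yCoord k : ℝ)]

/-- The set of lattice points that the path passes by. -/
def vertexSet (γ : OrientedPath) : Set (EuclideanSpace ℝ (Fin 2)) :=
  {p | ∃ k ≤ γ.length, p = γ.vertex k}

/-- The area enclosed by the path and the two coordinate axes: a right step from `γ(k)` to
`γ(k+1)` contributes a column of width one and height `yCoord k`, a down step contributes
nothing. -/
def area (γ : OrientedPath) : ℕ :=
  ∑ k ∈ Finset.range γ.length, (γ.xCoord (k + 1) - γ.xCoord k) * γ.yCoord k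

/-- The non-zero extremal points of the convex hull of `γ ∪ {(0, 0)}`. -/
def extremalPoints (γ : OrientedPath) : Set (EuclideanSpace ℝ (Fin 2)) :=
  (convexHull ℝ (γ.vertexSet ∪ {0})).extremePoints ℝ \ {0}

end OrientedPath

/-- `b` lies weakly to the right of and weakly below `a`. Points of an oriented path are totally
ordered by this relation, in the order in which they are visited. -/
def DownRight (a b : EuclideanSpace ℝ (Fin 2)) : Prop :=
  a 0 ≤ b 0 ∧ b 1 ≤ a 1

namespace OrientedPath

/-- `[a, b]` is a facet of the least concave majorant of `γ`, with left endpoint `a` and right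
endpoint `b`: two distinct extremal points that are consecutive along the majorant. -/
def IsFacet (γ : OrientedPath) (a b : EuclideanSpace ℝ (Fin 2)) : Prop :=
  a ∈ γ.extremalPoints ∧ b ∈ γ.extremalPoints ∧ a ≠ b ∧ DownRight a b ∧
    ∀ c ∈ γ.extremalPoints, DownRight a c → DownRight c b → c = a ∨ c = b

/-- `[a, b]` is a facet that intersects the line `{y = x}`. -/
def IsDiagonalFacet (γ : OrientedPath) (a b : EuclideanSpace ℝ (Fin 2)) : Prop :=
  γ.IsFacet a b ∧ ∃ p ∈ segment ℝ a b, p 1 = p 0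

/-- `[a, b]` is the mean facet: the leftmost of the facets that intersect the line `{y = x}`. -/
def IsMeanFacet (γ : OrientedPath) (a b : EuclideanSpace ℝ (Fin 2)) : Prop :=
  γ.IsDiagonalFacet a b ∧ ∀ a' b', γ.IsDiagonalFacet a' b' → DownRight a a'

open Classical in
/-- The mean facet length: the Euclidean distance of the endpoints of the mean facet. (The value
`0` is used for the degenerate paths contained in a coordinate axis, which have no facet.) -/
def meanFL (γ : OrientedPath) : ℝ :=
  if h : ∃ e : EuclideanSpace ℝ (Fin 2) × EuclideanSpace ℝ (Fin 2), γ.IsMeanFacet e.1 e.2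
  then dist h.choose.1 h.choose.2 else 0

/-- Every set of paths is an event. -/
instance : MeasurableSpace OrientedPath := ⊤

/-- The law `ℙ_lam` on paths: `γ` has probability `lam ^ |γ| / Z` with `Z = (1 - 2 lam)⁻¹`. -/
def law (lam : ℝ) : Measure OrientedPath :=
  Measure.sum fun γ => ENNReal.ofReal (lam ^ γ.length / (1 - 2 * lam)⁻¹) • Measure.dirac γ

/-- The law `ℙ_lam` conditioned on the event that the enclosed area is at least `N ^ 2`. -/
def areaLaw (lam : ℝ) (N : ℕ) : Measure OrientedPath :=
  ProbabilityTheory.cond (law lam) {γ | N ^ 2 ≤ γ.area}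

end OrientedPath

end

/-! A path is its word of steps, `pairArea` is its area, and it meets the line y = x exactly after
`s.count false` steps. A long mean facet yields a `DiagonalChord`: times i ≤ `s.count false` ≤ j,
with j - i at least the length of the facet, whose chord lies above the whole path.

The main mechanism is that a long facet wastes area. In a uniform bridge of n steps, the area
exceeds half its bounding rectangle by x with probability about exp(-C x²/n³). If the largest excess
over the chord sits within ηn steps of an end (`EndMax`), the same area needs a fluctuation x/n over
only ηn steps, which costs exp(-c x²/(η n³)). For small η such bridges of area at least α are
therefore at most a constant times as many as all bridges of area at least α + n^(3/2)
(`exists_card_endMax_le`). Rearranging the steps of the block that carries the facet transfers this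
to paths: area at least N² together with a facet on n steps weighs at most a constant times area at
least N² + c n^(3/2) (`mass_longFacetBlock_le`).

Extra area is expensive. Erasing the step at the diagonal is at most two-to-one, saves a factor lam
and loses at most the square root of the area, so extra area x costs exp(-c x/N)
(`exists_mass_areaGe_add_le`). With n of order t N^(2/3) and x of order n^(3/2), the price is exp(-c
t^(3/2)). Rounding the ends of the facet to a grid, measured from the diagonal, leaves a summable
union bound (`exists_mass_balancedChord_le`).

This needs facets that are neither flat nor steep and paths of length O(N). Longer paths are
exponentially unlikely in N (`exists_mass_length_le`). A nearly flat facet forces, by concavity, a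
nearly flat initial piece of order N, which can be replaced by many heavier pieces without losing
area (`exists_mass_thinPrefix_le`); steep facets are flat ones after reflection. Since t ≤ N^(2/3),
errors exponential in N are below exp(-c t^(3/2)). -/

namespace StepWord

/-! ### Words, area and reflection -/

/-- The number of pairs consisting of a right step and a later down step. -/
def pairArea : List Bool → ℕ
  | [] => 0
  | true :: s => s.count false + pairArea s
  | false :: s => pairArea s

@[simp] theorem pairArea_nil : pairArea [] = 0 := rfl
@[simp] theorem pairArea_true_cons (s : List Bool) :
    pairArea (true :: s) = s.count false + pairArea s := rfl
@[simp] theorem pairArea_false_cons (s : List Bool) : pairArea (false :: s) = pairArea s := rfl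

theorem pairArea_append (s t : List Bool) :
    pairArea (s ++ t) = pairArea s + pairArea t + s.count true * t.count false := by
  induction s with
  | nil => simp
  | cons a s ih => cases a <;> simp [ih]; ring

theorem count_true_add_count_false (s : List Bool) :
    s.count true + s.count false = s.length := by
  induction s with
  | nil => simp
  | cons a s ih => cases a <;> simp <;> omega

/-- The reflection of a path in the diagonal. -/
def dual (s : List Bool) : List Bool := (s.map (!·)).reverse

@[simp] theorem dual_dual (s : List Bool) : dual (dual s) = s := by
  simp [dual, List.map_reverse, Function.comp_def]

@[simp] theorem length_dual (s : List Bool) : (dual s).length = s.length := by simp [dual]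

@[simp] theorem dual_append (s t : List Bool) : dual (s ++ t) = dual t ++ dual s := by simp [dual]

theorem dual_injective : Function.Injective dual :=
  Function.LeftInverse.injective dual_dual

@[simp] theorem count_true_dual (s : List Bool) : (dual s).count true = s.count false := by
  induction s with
  | nil => simp [dual]
  | cons a s ih => cases a <;> simp_all [dual]

@[simp] theorem count_false_dual (s : List Bool) : (dual s).count false = s.count true := by
  rw [← count_true_dual, dual_dual]

theorem dual_cons (a : Bool) (s : List Bool) : dual (a :: s) = dual s ++ [!a] := by simp [dual]

@[simp] theorem pairArea_dual (s : List Bool) : pairArea (dual s) = pairArea s := by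
  induction s with
  | nil => rfl
  | cons a s ih => cases a <;> simp [dual_cons, pairArea_append, ih]; ring

theorem take_dual (s : List Bool) (k : ℕ) (hk : k ≤ s.length) :
    (dual s).take k = dual (s.drop (s.length - k)) := by
  have h : dual s = dual (s.drop (s.length - k)) ++ dual (s.take (s.length - k)) := by
    rw [← dual_append, List.take_append_drop]
  rw [h, List.take_append_of_le_length (by simp; omega), List.take_of_length_le (by simp; omega)]

theorem pairArea_reverse (s : List Bool) :
    pairArea s.reverse + pairArea s = s.count true * s.count false := by
  induction s with
  | nil => rfl
  | cons a s ih =>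
    cases a <;> simp only [List.reverse_cons, pairArea_append, pairArea_true_cons,
      pairArea_false_cons, pairArea_nil, List.count_reverse, List.count_cons_self, List.count_nil,
      List.count_cons] <;> simp <;> nlinarith

theorem pairArea_le (s : List Bool) : pairArea s ≤ s.count true * s.count false := by
  have := pairArea_reverse s
  omega

/-- The number of right steps among the first `k` steps. -/
def rights (s : List Bool) (k : ℕ) : ℕ := (s.take k).count true

@[simp] theorem rights_zero (s : List Bool) : rights s 0 = 0 := by simp [rights]

@[simp] theorem rights_nil (k : ℕ) : rights [] k = 0 := by simp [rights]

@[simp] theorem rights_length (s : List Bool) : rights s s.length = s.count true := by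
  simp [rights]

@[simp] theorem rights_true_cons (s : List Bool) (k : ℕ) :
    rights (true :: s) (k + 1) = rights s k + 1 := by simp [rights]

@[simp] theorem rights_false_cons (s : List Bool) (k : ℕ) :
    rights (false :: s) (k + 1) = rights s k := by simp [rights]

theorem rights_le (s : List Bool) (k : ℕ) : rights s k ≤ k :=
  List.count_le_length.trans (by simp)

theorem rights_add (s : List Bool) (i k : ℕ) :
    rights s (i + k) = rights s i + rights (s.drop i) k := by
  simp [rights, List.take_add]

theorem rights_mono (s : List Bool) : Monotone (rights s) := by
  intro i j hij
  obtain ⟨k, rfl⟩ := Nat.exists_eq_add_of_le hij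
  rw [rights_add]; omega

theorem rights_add_le (s : List Bool) (i k : ℕ) : rights s (i + k) ≤ rights s i + k := by
  rw [rights_add]; have := rights_le (s.drop i) k; omega

theorem rights_take (s : List Bool) {k n : ℕ} (h : k ≤ n) : rights (s.take n) k = rights s k := by
  simp [rights, List.take_take, h]

theorem rights_add_count_drop (s : List Bool) (k : ℕ) :
    rights s k + (s.drop k).count true = s.count true := by
  rw [rights, ← List.count_append, List.take_append_drop]

theorem count_false_take (s : List Bool) {k : ℕ} (hk : k ≤ s.length) :
    rights s k + (s.take k).count false = k := by
  rw [rights, count_true_add_count_false]; simpa using hk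

theorem rights_dual (s : List Bool) {k : ℕ} (hk : k ≤ s.length) :
    rights (dual s) k + s.count true = k + rights s (s.length - k) := by
  have h1 : rights (dual s) k = (s.drop (s.length - k)).count false := by
    rw [rights, take_dual s k hk, count_true_dual]
  have h2 := rights_add_count_drop s (s.length - k)
  have h3 := count_true_add_count_false (s.drop (s.length - k))
  rw [List.length_drop] at h3
  omega

/-- This writes the area as a sum over time, so that a uniform bound on the number of right steps
bounds the area. -/
theorem two_mul_pairArea_add (s : List Bool) :
    2 * pairArea s + s.count true * (s.count true + 1) =
      2 * ∑ k ∈ Finset.range (s.length + 1), rights s k := by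
  induction s with
  | nil => simp
  | cons a s ih =>
    have h := count_true_add_count_false s
    rw [List.length_cons, Finset.sum_range_succ']
    cases a
    · simpa using ih
    · simp only [rights_true_cons, Finset.sum_add_distrib, rights_zero, Finset.sum_const,
        Finset.card_range, smul_eq_mul, mul_one, pairArea_true_cons, List.count_cons_self,
        mul_add, ← ih]
      rw [← h]; ring

/-! ### Counting bridges -/

/-- The words with `m` right steps and `h` down steps. -/
def bridges : ℕ → ℕ → Finset (List Bool)
  | 0, 0 => {[]}
  | m + 1, 0 => (bridges m 0).image (true :: ·)
  | 0, h + 1 => (bridges 0 h).image (false :: ·)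
  | m + 1, h + 1 => (bridges m (h + 1)).image (true :: ·) ∪ (bridges (m + 1) h).image (false :: ·)

theorem mem_bridges {b : List Bool} {m h : ℕ} :
    b ∈ bridges m h ↔ b.count true = m ∧ b.count false = h := by
  induction b generalizing m h with
  | nil => rcases m with _ | m <;> rcases h with _ | h <;> simp [bridges]
  | cons a b ih =>
    rcases m with _ | m <;> rcases h with _ | h <;> cases a <;> simp [bridges, ih]

theorem length_of_mem_bridges {b : List Bool} {m h : ℕ} (hb : b ∈ bridges m h) :
    b.length = m + h := by
  rw [mem_bridges] at hb
  rw [← count_true_add_count_false, hb.1, hb.2]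

theorem card_filter_bridges_succ_succ (m h : ℕ) (P : List Bool → Prop) [DecidablePred P] :
    ((bridges (m + 1) (h + 1)).filter P).card =
      ((bridges m (h + 1)).filter fun b => P (true :: b)).card +
        ((bridges (m + 1) h).filter fun b => P (false :: b)).card := by
  rw [bridges, Finset.filter_union, Finset.card_union_of_disjoint, Finset.filter_image,
    Finset.filter_image, Finset.card_image_of_injective, Finset.card_image_of_injective]
  · exact List.cons_injective
  · exact List.cons_injective
  · rw [Finset.disjoint_left]
    intro x hx hy
    simp only [Finset.mem_filter, Finset.mem_image] at hx hy
    obtain ⟨⟨u, _, rfl⟩, _⟩ := hx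
    obtain ⟨⟨v, _, hv⟩, _⟩ := hy
    simp at hv

theorem card_bridges (m h : ℕ) : (bridges m h).card = (m + h).choose m := by
  induction m generalizing h with
  | zero =>
    induction h with
    | zero => simp [bridges]
    | succ h ih => 
      rw [bridges, Finset.card_image_of_injective _ List.cons_injective, ih]; simp
  | succ m ihm =>
    induction h with
    | zero => 
      rw [bridges, Finset.card_image_of_injective _ List.cons_injective, ihm]; simp
    | succ h ih =>
      have := card_filter_bridges_succ_succ m h (fun _ => True)
      simp only [Finset.filter_true] at this
      rw [this, ihm, ih, show m + 1 + (h + 1) = (m + (h + 1)) + 1 by ring, Nat.choose_succ_succ,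
        show m + 1 + h = m + (h + 1) by ring]

theorem dual_mem_bridges {b : List Bool} {m h : ℕ} : dual b ∈ bridges h m ↔ b ∈ bridges m h := by
  simp [mem_bridges, and_comm]

theorem area_eq_pairArea (γ : OrientedPath) : γ.area = pairArea γ.steps := by
  obtain ⟨s⟩ := γ
  simp only [OrientedPath.area, OrientedPath.length, OrientedPath.xCoord, OrientedPath.yCoord]
  induction s with
  | nil => rfl
  | cons a s ih =>
    rw [List.length_cons, Finset.sum_range_succ']
    cases a
    · simpa using ih
    · simp [← ih]; ring


/-! ### Weights of sets of words and mass transport -/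

/-- The total weight `∑ lam ^ |s|` of a set of words. -/
noncomputable def mass (lam : ℝ) (E : Set (List Bool)) : ENNReal :=
  ∑' s, E.indicator (fun s => ENNReal.ofReal (lam ^ s.length)) s

theorem mass_mono (lam : ℝ) {E F : Set (List Bool)} (h : E ⊆ F) : mass lam E ≤ mass lam F :=
  ENNReal.tsum_le_tsum fun s => Set.indicator_le_indicator_of_subset h (fun _ => zero_le) s

theorem mass_empty (lam : ℝ) : mass lam ∅ = 0 := by simp [mass]

theorem mass_union_le (lam : ℝ) (E F : Set (List Bool)) :
    mass lam (E ∪ F) ≤ mass lam E + mass lam F := by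
  rw [mass, mass, mass, ← ENNReal.tsum_add]
  refine ENNReal.tsum_le_tsum fun s => ?_
  by_cases hE : s ∈ E <;> by_cases hF : s ∈ F <;> simp [hE, hF]

theorem mass_biUnion_le (lam : ℝ) {ι : Type*} (I : Finset ι) (E : ι → Set (List Bool)) :
    mass lam (⋃ i ∈ I, E i) ≤ ∑ i ∈ I, mass lam (E i) := by
  classical
  induction I using Finset.induction_on with
  | empty => simp [mass_empty]
  | insert i I hi ih =>
    rw [Finset.set_biUnion_insert, Finset.sum_insert hi]
    exact (mass_union_le _ _ _).trans (by gcongr)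

/-- The weight of each `s` in `E` is split evenly over `T s`, and `hS` bounds the total that a
single word receives. The modifications of paths below are all compared in this way. -/
theorem mass_le_of_transport {lam : ℝ} (h0 : 0 < lam) {E E' : Set (List Bool)}
    (T S : List Bool → Finset (List Bool)) {C : ℝ} (hC : 0 ≤ C)
    (hT : ∀ s ∈ E, (T s).Nonempty) (hTS : ∀ s ∈ E, ∀ s' ∈ T s, s' ∈ E' ∧ s ∈ S s')
    (hS : ∀ s' ∈ E', ∑ s ∈ S s', lam ^ s.length / (T s).card ≤ C * lam ^ s'.length) :
    mass lam E ≤ ENNReal.ofReal C * mass lam E' := by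
  classical
  set K : List Bool → List Bool → ENNReal := fun s s' =>
    if s ∈ E ∧ s' ∈ T s then ENNReal.ofReal (lam ^ s.length / (T s).card) else 0 with hK
  have h1 : ∀ s, E.indicator (fun s => ENNReal.ofReal (lam ^ s.length)) s ≤ ∑' s', K s s' := by
    intro s
    by_cases hs : s ∈ E
    · have hc : (0 : ℝ) < (T s).card := by exact_mod_cast (hT s hs).card_pos
      calc E.indicator (fun s => ENNReal.ofReal (lam ^ s.length)) s
          = ENNReal.ofReal (lam ^ s.length) := by simp [hs]
        _ = ENNReal.ofReal ((T s).card * (lam ^ s.length / (T s).card)) := by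
            congr 1; field_simp
        _ = ∑ s' ∈ T s, K s s' := by
            rw [ENNReal.ofReal_mul hc.le, ENNReal.ofReal_natCast, ← nsmul_eq_mul,
              ← Finset.sum_const]
            refine Finset.sum_congr rfl fun s' hs' => ?_
            simp [hK, hs, hs']
        _ ≤ _ := ENNReal.sum_le_tsum _
    · simp [hs]
  have h2 : ∀ s', ∑' s, K s s' ≤
      ENNReal.ofReal C * E'.indicator (fun s => ENNReal.ofReal (lam ^ s.length)) s' := by
    intro s'
    by_cases hs' : s' ∈ E'
    · rw [tsum_eq_sum (s := S s')]
      · calc ∑ s ∈ S s', K s s' ≤ ∑ s ∈ S s', ENNReal.ofReal (lam ^ s.length / (T s).card) := by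
              refine Finset.sum_le_sum fun s _ => ?_
              simp only [hK]; split_ifs <;> simp
          _ = ENNReal.ofReal (∑ s ∈ S s', lam ^ s.length / (T s).card) := by
              rw [ENNReal.ofReal_sum_of_nonneg]
              intro s _; positivity
          _ ≤ ENNReal.ofReal (C * lam ^ s'.length) := ENNReal.ofReal_le_ofReal (hS s' hs')
          _ = _ := by rw [ENNReal.ofReal_mul hC]; simp [hs']
      · intro s hs
        simp only [hK, ite_eq_right_iff]
        rintro ⟨h3, h4⟩
        exact absurd (hTS s h3 s' h4).2 hs
    · have : ∀ s, K s s' = 0 := by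
        intro s
        simp only [hK, ite_eq_right_iff]
        rintro ⟨h3, h4⟩
        exact absurd (hTS s h3 s' h4).1 hs'
      simp [this]
  calc mass lam E ≤ ∑' s, ∑' s', K s s' := ENNReal.tsum_le_tsum h1
    _ = ∑' s', ∑' s, K s s' := ENNReal.tsum_comm
    _ ≤ _ := (ENNReal.tsum_le_tsum h2).trans_eq ENNReal.tsum_mul_left

theorem mass_univ_le {lam : ℝ} (h0 : 0 < lam) (h1 : lam < 1 / 2) :
    mass lam Set.univ ≤ ENNReal.ofReal (1 / (1 - 2 * lam)) := by
  have hsum : ∀ n : ℕ, ∑' v : {s : List Bool // s.length = n},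
      ENNReal.ofReal (lam ^ v.1.length) = ENNReal.ofReal ((2 * lam) ^ n) := by
    intro n
    have : ∀ v : {s : List Bool // s.length = n},
        ENNReal.ofReal (lam ^ v.1.length) = ENNReal.ofReal (lam ^ n) := fun v => by rw [v.2]
    simp_rw [this]
    have hc : ∑' _v : List.Vector Bool n, ENNReal.ofReal (lam ^ n) =
        ENNReal.ofReal ((2 * lam) ^ n) := by
      rw [tsum_fintype, Finset.sum_const, Finset.card_univ, card_vector, Fintype.card_bool,
        nsmul_eq_mul, ← ENNReal.ofReal_natCast, ← ENNReal.ofReal_mul (by positivity), mul_pow]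
      simp
    exact hc
  have h2 : (0 : ℝ) ≤ 2 * lam := by positivity
  rw [mass]
  simp only [Set.indicator_univ]
  rw [← (Equiv.sigmaFiberEquiv (List.length (α := Bool))).tsum_eq, ENNReal.tsum_sigma']
  simp only [Equiv.sigmaFiberEquiv, Equiv.coe_fn_mk]
  calc _ = ∑' n : ℕ, ENNReal.ofReal ((2 * lam) ^ n) := tsum_congr hsum
    _ = ENNReal.ofReal (∑' n : ℕ, (2 * lam) ^ n) :=
        (ENNReal.ofReal_tsum_of_nonneg (fun n => by positivity)
          (summable_geometric_of_lt_one h2 (by linarith))).symm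
    _ ≤ _ := by rw [tsum_geometric_of_lt_one h2 (by linarith), one_div]

theorem mass_length_ge_le {lam : ℝ} (h0 : 0 < lam) (h1 : lam < 1 / 2) (L : ℕ) :
    mass lam {s | L ≤ s.length} ≤ ENNReal.ofReal ((2 * lam) ^ L / (1 - 2 * lam)) := by
  have step : ∀ L : ℕ, mass lam {s | L + 1 ≤ s.length} ≤
      ENNReal.ofReal (2 * lam) * mass lam {s | L ≤ s.length} := by
    intro L
    refine mass_le_of_transport h0 (fun s => {s.tail}) (fun s => {true :: s, false :: s})
      (by positivity) (by simp) ?_ ?_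
    · rintro (_ | ⟨a, s⟩) hs s' hs'
      · simp at hs
      · simp only [List.tail_cons, Finset.mem_singleton] at hs'
        subst hs'
        cases a <;> simpa using hs
    · intro s _
      rw [Finset.sum_pair (by simp)]
      simp only [List.length_cons, Finset.card_singleton, Nat.cast_one, div_one, pow_succ]
      linarith
  induction L with
  | zero => simpa using (mass_mono lam (Set.subset_univ _)).trans (mass_univ_le h0 h1)
  | succ L ih =>
    refine (step L).trans ((mul_le_mul_right ih _).trans_eq ?_)
    rw [← ENNReal.ofReal_mul (by positivity)]
    congr 1; ring

theorem ofReal_pow_le_mass {lam : ℝ} {E : Set (List Bool)} {s : List Bool}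
    (hs : s ∈ E) : ENNReal.ofReal (lam ^ s.length) ≤ mass lam E := by
  have h := ENNReal.le_tsum (f := E.indicator (fun s => ENNReal.ofReal (lam ^ s.length))) s
  rwa [Set.indicator_of_mem hs] at h

theorem mass_dual (lam : ℝ) (E : Set (List Bool)) : mass lam {s | dual s ∈ E} = mass lam E := by
  rw [mass, mass]
  let e : List Bool ≃ List Bool := ⟨dual, dual, dual_dual, dual_dual⟩
  rw [← e.tsum_eq]
  refine tsum_congr fun s => ?_
  by_cases hs : s ∈ E
  · rw [Set.indicator_of_mem hs, Set.indicator_of_mem (by simpa [e] using hs)]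
    simp [e]
  · rw [Set.indicator_of_notMem hs, Set.indicator_of_notMem (by simpa [e] using hs)]

/-! ### Tail of the area -/

/-- The words whose area is at least `y`. -/
def areaGe (y : ℝ) : Set (List Bool) := {s | y ≤ pairArea s}

theorem areaGe_anti {x y : ℝ} (h : x ≤ y) : areaGe y ⊆ areaGe x :=
  fun _ hs => h.trans hs

theorem le_mass_areaGe {lam : ℝ} (N : ℕ) :
    ENNReal.ofReal (lam ^ (2 * N)) ≤ mass lam (areaGe ((N : ℝ) ^ 2)) := by
  have hs : List.replicate N true ++ List.replicate N false ∈ areaGe ((N : ℝ) ^ 2) := by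
    have h1 : pairArea (List.replicate N true ++ List.replicate N false) ≥ N ^ 2 := by
      rw [pairArea_append]
      simp [pow_two]
    rw [areaGe, Set.mem_ofPred_eq]
    exact_mod_cast h1
  have := ofReal_pow_le_mass (lam := lam) hs
  rwa [List.length_append, List.length_replicate, List.length_replicate, ← two_mul] at this

/-- After k steps the height is `s.count false` + `rights s k` - k, so height and abscissa agree at
k = `s.count false`. This is the time of the diagonal throughout. -/
theorem rights_diagonal (s : List Bool) :
    (s.drop (s.count false)).count false = rights s (s.count false) := by
  have h := count_true_add_count_false s
  have h1 := count_false_take s (k := s.count false) (by omega)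
  have h2 : (s.take (s.count false)).count false + (s.drop (s.count false)).count false =
      s.count false := by rw [← List.count_append, List.take_append_drop]
  omega

theorem rights_diagonal_sq_le (s : List Bool) : rights s (s.count false) ^ 2 ≤ pairArea s := by
  have h := pairArea_append (s.take (s.count false)) (s.drop (s.count false))
  rw [List.take_append_drop, rights_diagonal] at h
  rw [h, pow_two]
  exact Nat.le_add_left _ _

/-- A down step takes part in one pair for each earlier right step, a right step in one for each
later down step. At the diagonal these two numbers coincide. -/
theorem pairArea_delete (p q : List Bool) (a : Bool)
    (h : p.length = (p ++ a :: q).count false) :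
    pairArea (p ++ a :: q) = pairArea (p ++ q) + rights (p ++ a :: q) p.length := by
  have h1 := count_true_add_count_false p
  have h2 : rights (p ++ a :: q) p.length = p.count true := by simp [rights]
  rw [h2, pairArea_append, pairArea_append]
  cases a
  · simp at h ⊢; ring
  · have : p.count true = q.count false := by simp at h; omega
    simp [this]; ring

/-- The step at the diagonal is erased. The path lies above the square whose corner is its diagonal
point, so the lost area is at most the square root of the area; the shorter word gains a factor
1/lam and has at most two preimages. -/
theorem mass_areaGe_le {lam : ℝ} (h0 : 0 < lam) {y : ℝ} (hy : 1 ≤ y) :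
    mass lam (areaGe y) ≤ ENNReal.ofReal (2 * lam) * mass lam (areaGe (y - √y)) := by
  refine mass_le_of_transport h0
    (fun s => {s.take (s.count false) ++ s.drop (s.count false + 1)})
    -- Erasing a down step lowers `count false` by one and erasing a right step does not, so the two
    -- preimages have different insertion points.
    (fun s => {s.take (s.count false) ++ true :: s.drop (s.count false),
      s.take (s.count false + 1) ++ false :: s.drop (s.count false + 1)}) (by positivity)
    (by simp) ?_ ?_
  · intro s hs s' hs'
    rw [Finset.mem_singleton] at hs'
    have hlen := count_true_add_count_false s
    have harea : y ≤ pairArea s := hs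
    have hpos : 0 < pairArea s := by
      have : (0 : ℝ) < pairArea s := by linarith
      exact_mod_cast this
    have hd : s.count false < s.length := by
      by_contra hcon
      have : s.count true = 0 := by omega
      have h2 := pairArea_le s
      rw [this] at h2; omega
    obtain ⟨p, a, q, rfl, hp⟩ : ∃ p a q, s = p ++ a :: q ∧ p.length = s.count false :=
      ⟨s.take (s.count false), s[s.count false], s.drop (s.count false + 1), by simp,
        by simp; omega⟩
    have hs'' : s' = p ++ q := by
      rw [hs', ← hp]; simp
    subst hs''
    refine ⟨?_, ?_⟩
    · have h1 := pairArea_delete p q a hp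
      have h2 := rights_diagonal_sq_le (p ++ a :: q)
      rw [← hp] at h2
      rw [areaGe, Set.mem_ofPred_eq]
      set k := rights (p ++ a :: q) p.length
      have h3 : (pairArea (p ++ a :: q) : ℝ) = pairArea (p ++ q) + k := by exact_mod_cast h1
      have h4 : (k : ℝ) ^ 2 ≤ pairArea (p ++ a :: q) := by exact_mod_cast h2
      set A : ℝ := (pairArea (p ++ a :: q) : ℝ)
      -- What remains is A - √A ≥ y - √y, and x - √x increases on [1, ∞).
      have h5 : (k : ℝ) ≤ √A := Real.le_sqrt_of_sq_le h4
      have h6 : √y ≤ √A := Real.sqrt_le_sqrt harea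
      have h7 : 1 ≤ √y := Real.one_le_sqrt.2 hy
      have h8 : √y ^ 2 = y := Real.sq_sqrt (by linarith)
      have h9 : √A ^ 2 = A := Real.sq_sqrt (by positivity)
      nlinarith
    · rw [Finset.mem_insert, Finset.mem_singleton]
      cases a
      · right
        have h1 : (p ++ q).count false + 1 = p.length := by
          simp only [List.count_append, List.count_cons_self] at hp ⊢; omega
        rw [h1]; simp
      · left
        have h1 : (p ++ q).count false = p.length := by
          rw [hp]; simp
        rw [h1]; simp
  · intro s _
    refine (Finset.sum_le_sum_of_subset_of_nonneg (t := {_, _}) subset_rfl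
      (fun _ _ _ => by positivity)).trans ?_
    have hle := count_true_add_count_false s
    set s₁ := s.take (s.count false) ++ true :: s.drop (s.count false)
    set s₂ := s.take (s.count false + 1) ++ false :: s.drop (s.count false + 1)
    have hl1 : s₁.length = s.length + 1 := by simp [s₁]; omega
    have hl2 : s₂.length = s.length + 1 := by simp [s₂]; omega
    have hpos : (0 : ℝ) < lam ^ s.length := by positivity
    by_cases h12 : s₁ = s₂
    · rw [h12]; simp [hl2, pow_succ]; nlinarith
    · rw [Finset.sum_pair h12, hl1, hl2]; simp [pow_succ]; nlinarith

/-- As long as the area is at most (BN)², one erasure costs area at most BN, so each increment BN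
contributes a factor 2 lam. -/
theorem mass_areaGe_add_le {lam : ℝ} (h0 : 0 < lam) {N : ℕ} (hN : 1 ≤ N) {B : ℝ} (hB : 1 ≤ B)
    (j : ℕ) (hj : (N : ℝ) ^ 2 + j * (B * N) ≤ (B * N) ^ 2) :
    mass lam (areaGe ((N : ℝ) ^ 2 + j * (B * N))) ≤
      ENNReal.ofReal ((2 * lam) ^ j) * mass lam (areaGe ((N : ℝ) ^ 2)) := by
  have hN' : (1 : ℝ) ≤ N := by exact_mod_cast hN
  have hBN : 0 < B * N := by positivity
  induction j with
  | zero => simp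
  | succ j ih =>
    push_cast at hj ⊢
    set y : ℝ := (N : ℝ) ^ 2 + (j + 1) * (B * N)
    have hy : 1 ≤ y := by
      have : 0 ≤ (j + 1) * (B * N) := by positivity
      nlinarith
    have hsq : √y ≤ B * N := Real.sqrt_le_iff.2 ⟨hBN.le, hj⟩
    calc mass lam (areaGe y) ≤ ENNReal.ofReal (2 * lam) * mass lam (areaGe (y - √y)) :=
          mass_areaGe_le h0 hy
      _ ≤ ENNReal.ofReal (2 * lam) * mass lam (areaGe ((N : ℝ) ^ 2 + j * (B * N))) := by
          gcongr
          refine mass_mono _ (areaGe_anti ?_)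
          simp only [y]; linarith
      _ ≤ ENNReal.ofReal (2 * lam) * (ENNReal.ofReal ((2 * lam) ^ j) *
            mass lam (areaGe ((N : ℝ) ^ 2))) := by
          gcongr
          refine ih (le_trans ?_ hj)
          simp only [y]; nlinarith
      _ = _ := by
          rw [← mul_assoc, ← ENNReal.ofReal_mul (by positivity), ← pow_succ' (2 * lam)]

/-- Excess area of order `x` is exponentially unlikely at rate `x / N`. -/
theorem exists_mass_areaGe_add_le {lam : ℝ} (h0 : 0 < lam) (h1 : lam < 1 / 2) {a : ℝ}
    (ha : 0 ≤ a) : ∃ c C : ℝ, 0 < c ∧ 0 < C ∧ ∀ N : ℕ, 1 ≤ N → ∀ x : ℝ, 0 ≤ x → x ≤ a * N ^ 2 →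
      mass lam (areaGe ((N : ℝ) ^ 2 + x)) ≤
        ENNReal.ofReal (C * Real.exp (-c * (x / N))) * mass lam (areaGe ((N : ℝ) ^ 2)) := by
  have hl : 0 < -Real.log (2 * lam) := by
    have := Real.log_neg (x := 2 * lam) (by linarith) (by linarith); linarith
  set B : ℝ := 1 + a
  have hB : 1 ≤ B := by simp only [B]; linarith
  -- The prefactor pays for rounding x / (B N) down to a whole number of increments.
  refine ⟨-Real.log (2 * lam) / B, (2 * lam)⁻¹, by positivity, by positivity, ?_⟩
  intro N hN x hx hxa
  have hN' : (1 : ℝ) ≤ N := by exact_mod_cast hN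
  have hBN : 0 < B * N := by positivity
  set j := ⌊x / (B * N)⌋₊
  have hj1 : (j : ℝ) * (B * N) ≤ x := by
    have := Nat.floor_le (a := x / (B * N)) (by positivity)
    rwa [le_div_iff₀ hBN] at this
  have hj2 : x / (B * N) < j + 1 := Nat.lt_floor_add_one _
  have h3 : (N : ℝ) ^ 2 + j * (B * N) ≤ (B * N) ^ 2 := by
    have : (N : ℝ) ^ 2 + a * N ^ 2 ≤ (B * N) ^ 2 := by
      simp only [B]; nlinarith [sq_nonneg (N : ℝ), mul_nonneg ha (sq_nonneg (N : ℝ)),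
        mul_nonneg (mul_nonneg ha ha) (sq_nonneg (N : ℝ))]
    linarith
  refine (mass_mono lam (areaGe_anti (by linarith))).trans
    ((mass_areaGe_add_le h0 hN hB j h3).trans ?_)
  gcongr
  have h4 : (2 * lam) ^ j = Real.exp (Real.log (2 * lam) * j) := by
    rw [mul_comm (Real.log _), Real.exp_nat_mul, Real.exp_log (by positivity)]
  have h5 : (2 * lam)⁻¹ = Real.exp (-Real.log (2 * lam)) := by
    rw [Real.exp_neg, Real.exp_log (by positivity)]
  rw [h4, h5, ← Real.exp_add, Real.exp_le_exp]
  have h6 : -(-Real.log (2 * lam) / B) * (x / N) = Real.log (2 * lam) * (x / (B * N)) := by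
    field_simp
  rw [h6]
  nlinarith


/-! ### Facets as chords above the path -/

/-- The cross products of `Q` with `P` and `R` give its barycentric coordinates; `h` places `Q`
strictly on the origin's side of the line `P R`. -/
theorem mem_convexHull_triangle {P Q R : EuclideanSpace ℝ (Fin 2)} (hPQ : DownRight P Q)
    (hQR : DownRight Q R) (hP : 0 ≤ P 0) (hR : 0 ≤ R 1)
    (h : 0 < (P 1 - R 1) * (P 0 - Q 0) + (R 0 - P 0) * (P 1 - Q 1)) :
    Q ∈ convexHull ℝ ({0, P, R} : Set (EuclideanSpace ℝ (Fin 2))) := by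
  obtain ⟨h1, h2⟩ := hPQ
  obtain ⟨h3, h4⟩ := hQR
  set D := R 0 * P 1 - P 0 * R 1 with hD
  have hα : 0 ≤ R 0 * Q 1 - Q 0 * R 1 := by nlinarith
  have hβ : 0 ≤ Q 0 * P 1 - P 0 * Q 1 := by nlinarith
  have hDpos : 0 < D := by nlinarith
  have hQ : Q = ∑ t : Fin 3,
      ![(D - (R 0 * Q 1 - Q 0 * R 1) - (Q 0 * P 1 - P 0 * Q 1)) / D,
        (R 0 * Q 1 - Q 0 * R 1) / D, (Q 0 * P 1 - P 0 * Q 1) / D] t • ![0, P, R] t := by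
    ext t
    fin_cases t <;> simp [Fin.sum_univ_three] <;> field_simp <;> rw [hD] <;> ring
  have hmem : ∀ x ∈ ({0, P, R} : Set (EuclideanSpace ℝ (Fin 2))), x ∈ convexHull ℝ {0, P, R} :=
    fun x hx => subset_convexHull ℝ _ hx
  rw [hQ]
  refine (convex_convexHull ℝ _).sum_mem ?_ ?_ ?_
  · intro t _
    fin_cases t
    · exact div_nonneg (by simp only [hD]; nlinarith) hDpos.le
    · exact div_nonneg hα hDpos.le
    · exact div_nonneg hβ hDpos.le
  · simp only [Fin.sum_univ_three, Matrix.cons_val]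
    field_simp
    ring
  · intro t _
    fin_cases t <;> exact hmem _ (by simp)

theorem yCoord_eq (γ : OrientedPath) {k : ℕ} (hk : k ≤ γ.length) :
    γ.yCoord k + k = γ.steps.count false + rights γ.steps k := by
  have h1 := count_false_take γ.steps (k := k) hk
  have h2 : (γ.steps.take k).count false + (γ.steps.drop k).count false =
      γ.steps.count false := by rw [← List.count_append, List.take_append_drop]
  rw [OrientedPath.yCoord]
  omega

theorem vertex_zero (γ : OrientedPath) (k : ℕ) : γ.vertex k 0 = rights γ.steps k := rfl

theorem vertex_one (γ : OrientedPath) {k : ℕ} (hk : k ≤ γ.length) :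
    γ.vertex k 1 = γ.steps.count false + rights γ.steps k - k := by
  have h : γ.vertex k 1 = γ.yCoord k := rfl
  have h2 : ((γ.yCoord k + k : ℕ) : ℝ) = (γ.steps.count false + rights γ.steps k : ℕ) := by
    rw [yCoord_eq γ hk]
  push_cast at h2
  rw [h]; linarith

theorem vertex_nonneg (γ : OrientedPath) (k : ℕ) (t : Fin 2) : 0 ≤ γ.vertex k t := by
  fin_cases t
  · exact Nat.cast_nonneg _
  · exact Nat.cast_nonneg _

theorem downRight_vertex (γ : OrientedPath) {i j : ℕ} (hij : i ≤ j) (hj : j ≤ γ.length) :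
    DownRight (γ.vertex i) (γ.vertex j) := by
  refine ⟨?_, ?_⟩
  · rw [vertex_zero, vertex_zero]
    exact Nat.cast_le.2 (rights_mono γ.steps hij)
  · rw [vertex_one γ hj, vertex_one γ (hij.trans hj)]
    have h := rights_add_le γ.steps i (j - i)
    rw [Nat.add_sub_cancel' hij] at h
    have h2 : (rights γ.steps j : ℝ) ≤ rights γ.steps i + (j - i : ℕ) := by exact_mod_cast h
    rw [Nat.cast_sub hij] at h2
    linarith

theorem DownRight.antisymm {a b : EuclideanSpace ℝ (Fin 2)} (h : DownRight a b)
    (h' : DownRight b a) : a = b := by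
  ext t
  fin_cases t
  · exact le_antisymm h.1 h'.1
  · exact le_antisymm h'.2 h.2

theorem exists_of_mem_extremalPoints {γ : OrientedPath} {a : EuclideanSpace ℝ (Fin 2)}
    (ha : a ∈ γ.extremalPoints) : ∃ i ≤ γ.length, a = γ.vertex i := by
  rcases extremePoints_convexHull_subset ha.1 with h | h
  · exact h
  · exact absurd h ha.2

theorem not_mem_extremalPoints {γ : OrientedPath} {P Q R : EuclideanSpace ℝ (Fin 2)}
    (hP : P ∈ γ.vertexSet) (hR : R ∈ γ.vertexSet) (hPQ : DownRight P Q)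
    (hQR : DownRight Q R) (h : 0 < (P 1 - R 1) * (P 0 - Q 0) + (R 0 - P 0) * (P 1 - Q 1)) :
    Q ∉ γ.extremalPoints := by
  rintro ⟨hQ, hQ0⟩
  have hP0 : 0 ≤ P 0 := by obtain ⟨k, _, rfl⟩ := hP; exact vertex_nonneg γ k 0
  have hR0 : 0 ≤ R 1 := by obtain ⟨k, _, rfl⟩ := hR; exact vertex_nonneg γ k 1
  rw [(convex_convexHull ℝ _).mem_extremePoints_iff_mem_sdiff_convexHull_sdiff] at hQ
  refine hQ.2 (convexHull_mono ?_ (mem_convexHull_triangle hPQ hQR hP0 hR0 h))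
  have hs : ∀ x ∈ γ.vertexSet ∪ {0}, x ≠ Q →
      x ∈ convexHull ℝ (γ.vertexSet ∪ {0}) \ {Q} :=
    fun x hx hne => ⟨subset_convexHull ℝ _ hx, hne⟩
  rintro x (rfl | rfl | rfl)
  · exact hs _ (by simp) fun h => hQ0 h.symm
  · refine hs _ (Or.inl hP) ?_
    rintro rfl
    simp at h
  · refine hs _ (Or.inl hR) ?_
    rintro rfl
    nlinarith

theorem finite_vertexSet (γ : OrientedPath) : γ.vertexSet.Finite := by
  refine ((Set.finite_Iic γ.length).image γ.vertex).subset ?_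
  rintro p ⟨k, hk, rfl⟩
  exact ⟨k, hk, rfl⟩

theorem IsFacet.exists_vertex {γ : OrientedPath} {a b : EuclideanSpace ℝ (Fin 2)}
    (h : γ.IsFacet a b) : ∃ i j, i < j ∧ j ≤ γ.length ∧ a = γ.vertex i ∧ b = γ.vertex j := by
  obtain ⟨ha, hb, hab, hd, -⟩ := h
  obtain ⟨i, hi, rfl⟩ := exists_of_mem_extremalPoints ha
  obtain ⟨j, hj, rfl⟩ := exists_of_mem_extremalPoints hb
  refine ⟨i, j, ?_, hj, rfl, rfl⟩
  by_contra hcon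
  exact hab (DownRight.antisymm hd (downRight_vertex γ (not_lt.1 hcon) hi))

/-- All vertices lie below the line through the end points of a facet. -/
theorem IsFacet.support {γ : OrientedPath} {a b : EuclideanSpace ℝ (Fin 2)}
    (h : γ.IsFacet a b) {k : ℕ} (hk : k ≤ γ.length) :
    (a 1 - b 1) * γ.vertex k 0 + (b 0 - a 0) * γ.vertex k 1 ≤
      (a 1 - b 1) * a 0 + (b 0 - a 0) * a 1 := by
  obtain ⟨i, j, hij, hj, hai, hbj⟩ := IsFacet.exists_vertex h
  obtain ⟨ha, hb, hab, hd, hcons⟩ := h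
  have hva : a ∈ γ.vertexSet := ⟨i, by omega, hai⟩
  have hvb : b ∈ γ.vertexSet := ⟨j, hj, hbj⟩
  by_contra! hcon
  -- The normal functional of the facet attains its maximum over the hull at an extreme point `c`.
  -- If that maximum exceeded the value on the facet, then `c` to the left of `a` would put `a`
  -- below the chord from `c` to `b`, `c` to the right of `b` would put `b` below the chord from `a`
  -- to `c`, and `c` in between would contradict consecutiveness.
  set ψ : StrongDual ℝ (EuclideanSpace ℝ (Fin 2)) :=
    (a 1 - b 1) • EuclideanSpace.proj 0 + (b 0 - a 0) • EuclideanSpace.proj 1 with hψ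
  have hψ' : ∀ p, ψ p = (a 1 - b 1) * p 0 + (b 0 - a 0) * p 1 := fun p => by simp [hψ]
  set K := convexHull ℝ (γ.vertexSet ∪ {0})
  have hKc : IsCompact K :=
    ((finite_vertexSet γ).union (Set.finite_singleton 0)).isCompact_convexHull ℝ
  have hkK : γ.vertex k ∈ K := subset_convexHull ℝ _ (Or.inl ⟨k, hk, rfl⟩)
  obtain ⟨x, hx, hmax⟩ := hKc.exists_isMaxOn ⟨_, hkK⟩ ψ.continuous.continuousOn
  have hexp : IsExposed ℝ K (ψ.toExposed K) := ContinuousLinearMap.toExposed.isExposed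
  have hne : (ψ.toExposed K).Nonempty := ⟨x, hx, fun y hy => hmax hy⟩
  obtain ⟨c, hc⟩ := (hexp.isCompact hKc).extremePoints_nonempty hne
  have hcK : c ∈ K.extremePoints ℝ := hexp.isExtreme.extremePoints_subset_extremePoints hc
  have hcmax : ψ (γ.vertex k) ≤ ψ c := (extremePoints_subset hc).2 _ hkK
  have hψc : ψ a < ψ c := by
    refine lt_of_lt_of_le ?_ hcmax
    rw [hψ', hψ']; exact hcon
  have hψa : 0 ≤ ψ a := by
    rw [hψ']
    have h0 : 0 ≤ a 0 := hai ▸ vertex_nonneg γ i 0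
    have h1 : 0 ≤ a 1 := hai ▸ vertex_nonneg γ i 1
    have := mul_nonneg (sub_nonneg.2 hd.1) h1
    have := mul_nonneg (sub_nonneg.2 hd.2) h0
    linarith
  have hcext : c ∈ γ.extremalPoints := by
    refine ⟨hcK, ?_⟩
    rintro rfl
    rw [map_zero] at hψc
    linarith
  obtain ⟨l, hl, rfl⟩ := exists_of_mem_extremalPoints hcext
  have hvc : γ.vertex l ∈ γ.vertexSet := ⟨l, hl, rfl⟩
  rw [hψ', hψ'] at hψc
  have hli : i ≤ l := by
    by_contra hli
    have hdr := downRight_vertex γ (i := l) (j := i) (by omega) (by omega)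
    rw [← hai] at hdr
    exact not_mem_extremalPoints hvc hvb hdr hd (by nlinarith) ha
  have hlj : l ≤ j := by
    by_contra hlj
    have hdr := downRight_vertex γ (i := j) (j := l) (by omega) hl
    rw [← hbj] at hdr
    exact not_mem_extremalPoints hva hvc hd hdr (by nlinarith) hb
  rcases hcons _ hcext (hai ▸ downRight_vertex γ hli hl) (hbj ▸ downRight_vertex γ hlj hj)
    with h | h
  · rw [h] at hψc; linarith
  · rw [h] at hψc; linarith

/-- The steps `i, …, j - 1` of the word span a chord that meets the diagonal and lies above
the whole path. -/
structure DiagonalChord (s : List Bool) (i j : ℕ) : Prop where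
  lt : i < j
  le_length : j ≤ s.length
  left_le : i ≤ s.count false
  le_right : s.count false ≤ j
  support : ∀ k ≤ s.length, ((j : ℝ) - i) * ((rights s k : ℝ) - rights s i) ≤
    ((rights s j : ℝ) - rights s i) * ((k : ℝ) - i)

/-- Height is an affine function of time and abscissa, so the half plane below the facet becomes an
inequality between times and numbers of right steps. Meeting y = x places the left end weakly above
and the right end weakly below the diagonal, and the Euclidean length is at most the number of steps
j - i. -/
theorem IsDiagonalFacet.exists_diagonalChord {γ : OrientedPath}
    {a b : EuclideanSpace ℝ (Fin 2)} (h : γ.IsDiagonalFacet a b) :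
    ∃ i j, DiagonalChord γ.steps i j ∧ dist a b ≤ (j : ℝ) - i := by
  obtain ⟨hf, p, hp, hpd⟩ := h
  obtain ⟨i, j, hij, hj, hai, hbj⟩ := IsFacet.exists_vertex hf
  have ha0 : a 0 = rights γ.steps i := by rw [hai, vertex_zero]
  have hb0 : b 0 = rights γ.steps j := by rw [hbj, vertex_zero]
  have ha1 : a 1 = γ.steps.count false + rights γ.steps i - i := by
    rw [hai, vertex_one γ (by omega)]
  have hb1 : b 1 = γ.steps.count false + rights γ.steps j - j := by
    rw [hbj, vertex_one γ hj]
  have hd := hf.2.2.2.1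
  obtain ⟨hd0, hd1⟩ := hd
  refine ⟨i, j, ⟨hij, hj, ?_, ?_, ?_⟩, ?_⟩
  · obtain ⟨u, v, hu, hv, huv, rfl⟩ := hp
    simp only [PiLp.add_apply, PiLp.smul_apply, smul_eq_mul] at hpd
    have h1 : a 0 ≤ a 1 := by
      obtain rfl : u = 1 - v := by linarith
      nlinarith
    rw [ha0, ha1] at h1
    have : (i : ℝ) ≤ γ.steps.count false := by linarith
    exact_mod_cast this
  · obtain ⟨u, v, hu, hv, huv, rfl⟩ := hp
    simp only [PiLp.add_apply, PiLp.smul_apply, smul_eq_mul] at hpd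
    have h1 : b 1 ≤ b 0 := by
      obtain rfl : u = 1 - v := by linarith
      nlinarith
    rw [hb0, hb1] at h1
    have : (γ.steps.count false : ℝ) ≤ j := by linarith
    exact_mod_cast this
  · intro k hk
    have := IsFacet.support hf (k := k) hk
    rw [vertex_zero, vertex_one γ hk, ha0, ha1, hb0, hb1] at this
    nlinarith
  · rw [EuclideanSpace.dist_eq, Fin.sum_univ_two]
    refine Real.sqrt_le_iff.2 ⟨?_, ?_⟩
    · have : (i : ℝ) < j := by exact_mod_cast hij
      linarith
    · rw [Real.dist_eq, Real.dist_eq, sq_abs, sq_abs]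
      have : (j : ℝ) - i = (b 0 - a 0) + (a 1 - b 1) := by rw [ha0, ha1, hb0, hb1]; ring
      rw [this]
      nlinarith [mul_nonneg (sub_nonneg.2 hd0) (sub_nonneg.2 hd1)]

theorem exists_diagonalChord_of_le_meanFL {γ : OrientedPath} {l : ℝ} (hl : 0 < l)
    (h : l ≤ γ.meanFL) : ∃ i j, DiagonalChord γ.steps i j ∧ l ≤ (j : ℝ) - i := by
  rw [OrientedPath.meanFL] at h
  split_ifs at h with he
  · obtain ⟨i, j, h1, h2⟩ := IsDiagonalFacet.exists_diagonalChord he.choose_spec.1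
    exact ⟨i, j, h1, h.trans h2⟩
  · linarith


/-! ### Maximal inequality for uniform bridges -/

/-- This is the exponential moment of a centred Bernoulli variable; in exp y ≤ 1 + y + y² the linear
terms cancel on averaging. -/
theorem two_point_mgf_le {q x : ℝ} (hq : 0 ≤ q) (hq1 : q ≤ 1) (hx : 0 ≤ x) (hx1 : x ≤ 1) :
    q * Real.exp (x * (1 - q)) + (1 - q) * Real.exp (-(x * q)) ≤ Real.exp (x ^ 2) := by
  have key : ∀ y : ℝ, |y| ≤ 1 → Real.exp y ≤ 1 + y + y ^ 2 := fun y hy => by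
    have := (abs_le.1 (Real.abs_exp_sub_one_sub_id_le hy)).2
    linarith
  have h1 : 0 ≤ x * (1 - q) := mul_nonneg hx (by linarith)
  have h2 : 0 ≤ x * q := mul_nonneg hx hq
  have e1 := key (x * (1 - q)) (by rw [abs_of_nonneg h1]; nlinarith)
  have e2 := key (-(x * q)) (by rw [abs_neg, abs_of_nonneg h2]; nlinarith)
  have e3 := Real.add_one_le_exp (x ^ 2)
  have e4 := mul_le_mul_of_nonneg_left e1 hq
  have e5 := mul_le_mul_of_nonneg_left e2 (sub_nonneg.2 hq1)
  have e6 : q * (1 - q) ≤ 1 := by nlinarith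
  have e7 : q * (1 - q) * x ^ 2 ≤ 1 * x ^ 2 := mul_le_mul_of_nonneg_right e6 (sq_nonneg x)
  nlinarith

open Classical in
/-- Maximal inequality for the density of remaining right steps in a uniform bridge. -/
theorem card_density_le_le (v m h : ℕ) {ρ θ D : ℝ} (hD : 0 < D) (hθ : 0 ≤ θ) (hθD : θ ≤ D)
    (hv : D + v ≤ (m : ℝ) + h) :
    (((bridges m h).filter fun b =>
      ∃ k ≤ v, (m : ℝ) - rights b k ≤ ρ * ((m : ℝ) + h - k)).card : ℝ) ≤
      (m + h).choose m * Real.exp (θ * (ρ - m / ((m : ℝ) + h)) + θ ^ 2 * v / D ^ 2) := by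
  induction v generalizing m h with
  | zero =>
    have hn : (0 : ℝ) < (m : ℝ) + h := by simp at hv; linarith
    by_cases hm : (m : ℝ) ≤ ρ * ((m : ℝ) + h)
    · have h1 : 0 ≤ ρ - m / ((m : ℝ) + h) := sub_nonneg.2 ((div_le_iff₀ hn).2 hm)
      calc _ ≤ ((bridges m h).card : ℝ) := by exact_mod_cast Finset.card_filter_le _ _
        _ = (m + h).choose m * 1 := by rw [card_bridges, mul_one]
        _ ≤ _ := by gcongr; exact Real.one_le_exp (by positivity)
    · rw [Finset.filter_eq_empty_iff.2]
      · simp; positivity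
      · rintro b _ ⟨k, hk, hb⟩
        obtain rfl : k = 0 := by omega
        simp at hb
        exact hm hb
  | succ v ih =>
    push_cast at hv
    have hn : (0 : ℝ) < (m : ℝ) + h := by
      have : (0 : ℝ) ≤ v := Nat.cast_nonneg v
      linarith
    -- If the density already starts at or below `ρ`, the exponent is nonnegative and the trivial
    -- count suffices.
    by_cases hm : (m : ℝ) ≤ ρ * ((m : ℝ) + h)
    · have h1 : 0 ≤ ρ - m / ((m : ℝ) + h) := sub_nonneg.2 ((div_le_iff₀ hn).2 hm)
      calc _ ≤ ((bridges m h).card : ℝ) := by exact_mod_cast Finset.card_filter_le _ _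
        _ = (m + h).choose m * 1 := by rw [card_bridges, mul_one]
        _ ≤ _ := by gcongr; exact Real.one_le_exp (by positivity)
    have hkn : ∀ k : ℕ, k ≤ v + 1 → (0 : ℝ) < (m : ℝ) + h - k := fun k hk => by
      have : (k : ℝ) ≤ v + 1 := by exact_mod_cast hk
      linarith
    rcases m with _ | m
    · rw [Finset.filter_eq_empty_iff.2]
      · simp; positivity
      · rintro b hb ⟨k, hk, hbk⟩
        have h0 : rights b k = 0 := by
          have h2 := (mem_bridges.1 hb).1
          have h3 := rights_add_count_drop b k
          omega
        rw [h0] at hbk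
        have h3 := hkn k hk
        simp only [Nat.cast_zero, sub_self, zero_add] at hbk hm h3 hn
        have : ρ < 0 := by
          by_contra hρ
          exact hm (mul_nonneg (not_lt.1 hρ) hn.le)
        nlinarith
    rcases h with _ | h
    · rw [Finset.filter_eq_empty_iff.2]
      · simp; positivity
      · rintro b hb ⟨k, hk, hbk⟩
        have h3 := hkn k hk
        have h0 : rights b k ≤ k := rights_le b k
        have h0' : (rights b k : ℝ) ≤ k := by exact_mod_cast h0
        simp only [Nat.cast_zero, add_zero] at hbk hm h3 hn
        have : ρ < 1 := by nlinarith
        nlinarith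
    rw [card_filter_bridges_succ_succ]
    -- The first step is right with probability `q`, the current density, and moves the density of
    -- the remaining right steps by -(1 - q)/r or by q/r. The density is thus a martingale with
    -- increments at most 1/D, and each step costs a factor exp((θ/D)²).
    set r : ℝ := (m : ℝ) + h + 1 with hr
    have hrpos : 0 < r := by positivity
    have hDr : D + v ≤ r := by rw [hr]; push_cast at hv; linarith
    have hvn : (0 : ℝ) ≤ v := Nat.cast_nonneg v
    have ih1 := ih m (h + 1) (by push_cast; linarith)
    have ih2 := ih (m + 1) h (by push_cast; linarith)
    have hc1 : ((m + (h + 1)).choose m : ℝ) * (r + 1) =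
        ((m + 1 + (h + 1)).choose (m + 1) : ℝ) * (m + 1) := by
      have h1 := Nat.add_one_mul_choose_eq (m + (h + 1)) m
      rw [show m + (h + 1) + 1 = m + 1 + (h + 1) by ring] at h1
      have h2 : ((m + 1 + (h + 1) : ℕ) : ℝ) * ((m + (h + 1)).choose m : ℝ) =
          ((m + 1 + (h + 1)).choose (m + 1) : ℝ) * ((m + 1 : ℕ) : ℝ) := by exact_mod_cast h1
      push_cast at h2
      rw [hr]; linarith
    have hc2 : ((m + 1 + h).choose (m + 1) : ℝ) * (r + 1) =
        ((m + 1 + (h + 1)).choose (m + 1) : ℝ) * (h + 1) := by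
      have h1 : (m + 1 + (h + 1)).choose (m + 1) =
          (m + (h + 1)).choose m + (m + 1 + h).choose (m + 1) := by
        rw [show m + 1 + (h + 1) = (m + (h + 1)) + 1 by ring, Nat.choose_succ_succ,
          show m + 1 + h = m + (h + 1) by ring]
      have h2 : ((m + 1 + (h + 1)).choose (m + 1) : ℝ) =
          (m + (h + 1)).choose m + (m + 1 + h).choose (m + 1) := by exact_mod_cast h1
      have : ((m + 1 + h).choose (m + 1) : ℝ) * (r + 1) =
          ((m + 1 + (h + 1)).choose (m + 1) : ℝ) * (r + 1) -
          ((m + (h + 1)).choose m : ℝ) * (r + 1) := by rw [h2]; ring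
      rw [this, hc1, hr]; ring
    set c : ℝ := ((m + 1 + (h + 1)).choose (m + 1) : ℝ)
    have hcpos : 0 ≤ c := Nat.cast_nonneg _
    set q : ℝ := (m + 1) / (r + 1) with hq
    have hq0 : 0 ≤ q := by positivity
    have hq1 : q ≤ 1 := by
      rw [hq, div_le_one (by positivity), hr]
      have : (0 : ℝ) ≤ h := Nat.cast_nonneg h
      linarith
    have hc1' : ((m + (h + 1)).choose m : ℝ) = c * q := by
      rw [hq, ← mul_div_assoc, eq_div_iff (by positivity), hc1]
    have hc2' : ((m + 1 + h).choose (m + 1) : ℝ) = c * (1 - q) := by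
      have : 1 - q = (h + 1) / (r + 1) := by rw [hq, hr]; field_simp; ring
      rw [this, ← mul_div_assoc, eq_div_iff (by positivity), hc2]
    have hx0 : 0 ≤ θ / r := by positivity
    have hxD : θ / r ≤ θ / D := by gcongr; linarith
    have hx1 : θ / r ≤ 1 := (div_le_one hrpos).2 (by linarith)
    have hmgf := two_point_mgf_le hq0 hq1 hx0 hx1
    have he1 : θ * (ρ - m / ((m : ℝ) + (h + 1 : ℕ))) + θ ^ 2 * v / D ^ 2 =
        θ / r * (1 - q) + (θ * (ρ - q) + θ ^ 2 * v / D ^ 2) := by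
      rw [hq]; push_cast
      rw [show (m : ℝ) + (h + 1) = r by rw [hr]; ring]
      have : (m : ℝ) = r - h - 1 := by rw [hr]; ring
      field_simp
      rw [this]; ring
    have he2 : θ * (ρ - (m + 1 : ℕ) / (((m + 1 : ℕ) : ℝ) + h)) + θ ^ 2 * v / D ^ 2 =
        -(θ / r * q) + (θ * (ρ - q) + θ ^ 2 * v / D ^ 2) := by
      rw [hq]; push_cast
      rw [show (m : ℝ) + 1 + h = r by rw [hr]; ring]
      field_simp
      ring
    rw [he1, Real.exp_add, hc1'] at ih1
    rw [he2, Real.exp_add, hc2'] at ih2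
    set Z := Real.exp (θ * (ρ - q) + θ ^ 2 * v / D ^ 2)
    have hZ : 0 < Z := Real.exp_pos _
    have hsub1 : (((bridges m (h + 1)).filter fun b => ∃ k ≤ v + 1,
        ((m + 1 : ℕ) : ℝ) - rights (true :: b) k ≤
          ρ * (((m + 1 : ℕ) : ℝ) + (h + 1 : ℕ) - k)).card : ℝ) ≤
        ((bridges m (h + 1)).filter fun b => ∃ k ≤ v, (m : ℝ) - rights b k ≤
          ρ * ((m : ℝ) + (h + 1 : ℕ) - k)).card := by
      refine Nat.cast_le.2 (Finset.card_le_card (Finset.monotone_filter_right _ ?_))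
      rintro b _ ⟨_ | k, hk, hb⟩
      · simp at hb hm; linarith
      · refine ⟨k, by omega, ?_⟩
        rw [rights_true_cons] at hb
        push_cast at hb ⊢
        ring_nf at hb ⊢
        linarith
    have hsub2 : (((bridges (m + 1) h).filter fun b => ∃ k ≤ v + 1,
        ((m + 1 : ℕ) : ℝ) - rights (false :: b) k ≤
          ρ * (((m + 1 : ℕ) : ℝ) + (h + 1 : ℕ) - k)).card : ℝ) ≤
        ((bridges (m + 1) h).filter fun b => ∃ k ≤ v, ((m + 1 : ℕ) : ℝ) - rights b k ≤
          ρ * (((m + 1 : ℕ) : ℝ) + h - k)).card := by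
      refine Nat.cast_le.2 (Finset.card_le_card (Finset.monotone_filter_right _ ?_))
      rintro b _ ⟨_ | k, hk, hb⟩
      · simp at hb hm; linarith
      · refine ⟨k, by omega, ?_⟩
        rw [rights_false_cons] at hb
        push_cast at hb ⊢
        ring_nf at hb ⊢
        linarith
    have hfin : θ * (ρ - ((m + 1 : ℕ) : ℝ) / (((m + 1 : ℕ) : ℝ) + (h + 1 : ℕ))) +
        θ ^ 2 * ((v + 1 : ℕ) : ℝ) / D ^ 2 =
        (θ / D) ^ 2 + (θ * (ρ - q) + θ ^ 2 * v / D ^ 2) := by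
      rw [hq]; push_cast
      rw [show (m : ℝ) + 1 + (h + 1) = r + 1 by rw [hr]; ring]
      field_simp
      ring
    refine (Nat.cast_add _ _).trans_le
      ((add_le_add (hsub1.trans ih1) (hsub2.trans ih2)).trans ?_)
    calc c * q * (Real.exp (θ / r * (1 - q)) * Z) +
          c * (1 - q) * (Real.exp (-(θ / r * q)) * Z)
        = c * Z * (q * Real.exp (θ / r * (1 - q)) + (1 - q) * Real.exp (-(θ / r * q))) := by ring
      _ ≤ c * Z * Real.exp ((θ / r) ^ 2) := by gcongr
      _ ≤ c * Z * Real.exp ((θ / D) ^ 2) := by gcongr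
      _ = _ := by rw [hfin, Real.exp_add]; ring

-- With n = m + h, an excess `y` over the chord brings the density of the remaining right steps down
-- to at most m/n - y/n. With D = n/2 the exponent is -θ y/n + 4 θ² v/n², which is smallest at θ = n
-- y/(8 v).
open Classical in
theorem card_left_excess_le {m h v : ℕ} (hv : 1 ≤ v) (hvn : 2 * v ≤ m + h) {y : ℝ} (hy : 0 ≤ y) :
    (((bridges m h).filter fun b =>
      ∃ k ≤ v, k * (m / ((m : ℝ) + h)) + y ≤ rights b k).card : ℝ) ≤
      (m + h).choose m * Real.exp (-(y ^ 2 / (16 * v))) := by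
  have hv' : (1 : ℝ) ≤ v := by exact_mod_cast hv
  have hvn' : 2 * (v : ℝ) ≤ (m : ℝ) + h := by exact_mod_cast hvn
  have hn : (0 : ℝ) < (m : ℝ) + h := by linarith
  have hm0 : (0 : ℝ) ≤ m := Nat.cast_nonneg m
  rcases lt_or_ge (v : ℝ) y with hyv | hyv
  · rw [Finset.filter_eq_empty_iff.2]
    · simp; positivity
    · rintro b _ ⟨k, hk, hb⟩
      have h1 : (rights b k : ℝ) ≤ k := by exact_mod_cast rights_le b k
      have h2 : (k : ℝ) ≤ v := by exact_mod_cast hk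
      have h3 : 0 ≤ (k : ℝ) * (m / ((m : ℝ) + h)) := by positivity
      linarith
  set n : ℝ := (m : ℝ) + h
  have key := card_density_le_le v m h (ρ := m / n - y / n) (θ := n * (y / (8 * v)))
    (D := n / 2) (by positivity) (by positivity)
    (by
      have : y / (8 * v) ≤ 1 / 8 := by rw [div_le_div_iff₀ (by positivity) (by norm_num)]; linarith
      nlinarith) (by show n / 2 + v ≤ n; linarith)
  refine (Nat.cast_le.2 (Finset.card_le_card (Finset.monotone_filter_right _ ?_))).trans
    (key.trans_eq ?_)
  · rintro b hb ⟨k, hk, hbk⟩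
    refine ⟨k, hk, ?_⟩
    have h1 : (m / n - y / n) * (n - k) = m - k * (m / n) - y + y * k / n := by
      field_simp; ring
    have h2 : 0 ≤ y * k / n := by positivity
    show (m : ℝ) - rights b k ≤ (m / n - y / n) * (n - k)
    linarith
  · congr 2
    change n * (y / (8 * v)) * (m / n - y / n - m / n) +
      (n * (y / (8 * v))) ^ 2 * v / (n / 2) ^ 2 = -(y ^ 2 / (16 * v))
    field_simp
    ring

-- Reflection in the diagonal exchanges the first and the last steps and preserves the excess over
-- the chord.
open Classical in
theorem card_right_excess_le {m h v : ℕ} (hv : 1 ≤ v) (hvn : 2 * v ≤ m + h) {y : ℝ}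
    (hy : 0 ≤ y) :
    (((bridges m h).filter fun b =>
      ∃ k ≤ m + h, m + h ≤ k + v ∧ k * (m / ((m : ℝ) + h)) + y ≤ rights b k).card : ℝ) ≤
      (m + h).choose m * Real.exp (-(y ^ 2 / (16 * v))) := by
  have hv' : (1 : ℝ) ≤ v := by exact_mod_cast hv
  have hvn' : 2 * (v : ℝ) ≤ (m : ℝ) + h := by exact_mod_cast hvn
  have hn : (0 : ℝ) < (m : ℝ) + h := by linarith
  have key := card_left_excess_le (m := h) (h := m) hv (by omega) hy
  rw [show (h + m).choose h = (m + h).choose m by rw [add_comm, Nat.choose_symm_add]] at key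
  refine le_trans (Nat.cast_le.2 ?_) key
  refine Finset.card_le_card_of_injOn dual ?_ dual_injective.injOn
  intro b hb
  simp only [Finset.coe_filter, Set.mem_ofPred_eq] at hb ⊢
  obtain ⟨hb, k, hk, hkv, hbk⟩ := hb
  refine ⟨dual_mem_bridges.2 hb, m + h - k, by omega, ?_⟩
  have hlen := length_of_mem_bridges hb
  have h1 := rights_dual b (k := m + h - k) (by omega)
  rw [hlen, show m + h - (m + h - k) = k by omega, (mem_bridges.1 hb).1] at h1
  have h2 : (rights (dual b) (m + h - k) : ℝ) + m = ((m + h - k : ℕ) : ℝ) + rights b k := by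
    exact_mod_cast h1
  rw [Nat.cast_sub hk] at h2 ⊢
  push_cast at h2 ⊢
  have h3 : ((m : ℝ) + h - k) * (h / ((h : ℝ) + m)) = h - k + k * (m / ((m : ℝ) + h)) := by
    rw [add_comm (h : ℝ) m]; field_simp; ring
  rw [h3]; linarith

/-- In the sum over time the chord itself accounts for m h / 2, and each of the m + h + 1 times adds
at most `E`. -/
theorem two_mul_pairArea_le {b : List Bool} {m h : ℕ} (hb : b ∈ bridges m h) (hn : 0 < m + h)
    {E : ℝ} (hE : ∀ k ≤ m + h, (rights b k : ℝ) ≤ k * (m / ((m : ℝ) + h)) + E) :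
    (pairArea b : ℝ) ≤ m * h / 2 + ((m : ℝ) + h + 1) * E := by
  have hlen := length_of_mem_bridges hb
  have h1 := two_mul_pairArea_add b
  rw [hlen, (mem_bridges.1 hb).1] at h1
  have h2 : 2 * (pairArea b : ℝ) + m * (m + 1) =
      2 * ∑ k ∈ Finset.range (m + h + 1), (rights b k : ℝ) := by exact_mod_cast h1
  have h3 : ∑ k ∈ Finset.range (m + h + 1), (rights b k : ℝ) ≤
      ∑ k ∈ Finset.range (m + h + 1), (k * (m / ((m : ℝ) + h)) + E) :=
    Finset.sum_le_sum fun k hk => hE k (by rw [Finset.mem_range] at hk; omega)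
  have h4 : ∑ k ∈ Finset.range (m + h + 1), (k : ℝ) = ((m : ℝ) + h) * (m + h + 1) / 2 := by
    have := Finset.sum_range_id_mul_two (m + h + 1)
    rw [Nat.add_sub_cancel] at this
    have h5 := congrArg (Nat.cast (R := ℝ)) this
    push_cast at h5
    linarith
  have hn' : (0 : ℝ) < (m : ℝ) + h := by exact_mod_cast hn
  rw [Finset.sum_add_distrib, ← Finset.sum_mul, h4, Finset.sum_const, Finset.card_range,
    nsmul_eq_mul] at h3
  push_cast at h3
  have h6 : ((m : ℝ) + h) * (m + h + 1) / 2 * (m / ((m : ℝ) + h)) = m * (m + h + 1) / 2 := by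
    field_simp
  rw [h6] at h3
  nlinarith

/-! ### Bridges that are highest near an end -/

/-- The excess of the number of right steps over the chord is maximal close to an end. -/
def EndMax (η : ℝ) (b : List Bool) : Prop :=
  ∃ k₀ ≤ b.length, ((k₀ : ℝ) ≤ η * b.length ∨ (1 - η) * b.length ≤ k₀) ∧
    ∀ k ≤ b.length, (b.length : ℝ) * rights b k - k * b.count true ≤
      (b.length : ℝ) * rights b k₀ - k₀ * b.count true

theorem EndMax.exists_excess {η x : ℝ} {b : List Bool} {m h : ℕ} (he : EndMax η b)
    (hb : b ∈ bridges m h) (hn : 0 < m + h) (hx : (m : ℝ) * h / 2 + x ≤ pairArea b) :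
    ∃ k ≤ m + h, ((k : ℝ) ≤ η * ((m : ℝ) + h) ∨ (1 - η) * ((m : ℝ) + h) ≤ k) ∧
      k * (m / ((m : ℝ) + h)) + x / ((m : ℝ) + h + 1) ≤ rights b k := by
  obtain ⟨k₀, hk₀, hend, hmax⟩ := he
  have hlen := length_of_mem_bridges hb
  rw [hlen, (mem_bridges.1 hb).1] at hmax
  rw [hlen] at hk₀ hend
  push_cast at hmax hend
  have hn' : (0 : ℝ) < (m : ℝ) + h := by exact_mod_cast hn
  refine ⟨k₀, hk₀, hend, ?_⟩
  have h1 := two_mul_pairArea_le hb hn (E := rights b k₀ - k₀ * (m / ((m : ℝ) + h))) (by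
    intro k hk
    have := hmax k hk
    rw [← sub_nonneg] at this ⊢
    have h2 : k * (m / ((m : ℝ) + h)) + (rights b k₀ - k₀ * (m / ((m : ℝ) + h))) - rights b k =
        (((m : ℝ) + h) * rights b k₀ - k₀ * m - (((m : ℝ) + h) * rights b k - k * m)) /
          ((m : ℝ) + h) := by field_simp; ring
    rw [h2]; positivity)
  have h2 : x / ((m : ℝ) + h + 1) ≤ rights b k₀ - k₀ * (m / ((m : ℝ) + h)) := by
    rw [div_le_iff₀ (by positivity)]; linarith
  linarith

/-- The excess at a time within η(m + h) steps of an end is at most η(m + h). This keeps `x` in the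
range where the lower bound for large areas is available. -/
theorem EndMax.le_of_area {η x : ℝ} {b : List Bool} {m h : ℕ} (he : EndMax η b)
    (hb : b ∈ bridges m h) (hn : 0 < m + h) (hx : (m : ℝ) * h / 2 + x ≤ pairArea b) :
    x ≤ ((m : ℝ) + h + 1) * (η * ((m : ℝ) + h)) := by
  obtain ⟨k, hk, hend, hex⟩ := he.exists_excess hb hn hx
  have hn' : (0 : ℝ) < (m : ℝ) + h := by exact_mod_cast hn
  have hm0 : (0 : ℝ) ≤ m := Nat.cast_nonneg m
  have hh0 : (0 : ℝ) ≤ h := Nat.cast_nonneg h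
  have h0 : x / ((m : ℝ) + h + 1) ≤ η * ((m : ℝ) + h) := by
    rcases hend with hend | hend
    · have h1 : (rights b k : ℝ) ≤ k := by exact_mod_cast rights_le b k
      have h2 : 0 ≤ (k : ℝ) * (m / ((m : ℝ) + h)) := by positivity
      linarith
    · have h1 : (rights b k : ℝ) ≤ m := by
        have := rights_add_count_drop b k
        rw [(mem_bridges.1 hb).1] at this
        have : rights b k ≤ m := by omega
        exact_mod_cast this
      have hk' : (k : ℝ) ≤ (m : ℝ) + h := by exact_mod_cast hk
      have h2 : (m : ℝ) - k * (m / ((m : ℝ) + h)) = ((m : ℝ) + h - k) * (m / ((m : ℝ) + h)) := by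
        field_simp
      have h3 : (m : ℝ) / ((m : ℝ) + h) ≤ 1 := (div_le_one hn').2 (by linarith)
      have h4 : ((m : ℝ) + h - k) * (m / ((m : ℝ) + h)) ≤ ((m : ℝ) + h - k) * 1 :=
        mul_le_mul_of_nonneg_left h3 (by linarith)
      nlinarith
  rw [div_le_iff₀ (by positivity)] at h0
  linarith

-- Extra area `x` forces an excess x/(m + h + 1) within η(m + h) steps of an end, so the variance in
-- the Gaussian tail carries a factor `η`.
open Classical in
theorem card_endMax_le {η x : ℝ} {m h : ℕ} (hη : η ≤ 1 / 2) (hηn : 1 ≤ η * ((m : ℝ) + h))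
    (hx : 0 ≤ x) :
    (((bridges m h).filter fun b => EndMax η b ∧ (m : ℝ) * h / 2 + x ≤ pairArea b).card : ℝ) ≤
      2 * Real.exp (-((x / ((m : ℝ) + h + 1)) ^ 2 / (16 * (η * ((m : ℝ) + h))))) *
        (m + h).choose m := by
  have hm0 : (0 : ℝ) ≤ m := Nat.cast_nonneg m
  have hh0 : (0 : ℝ) ≤ h := Nat.cast_nonneg h
  have hn0 : 0 < m + h := by
    rcases Nat.eq_zero_or_pos (m + h) with h0 | h0
    · have : (m : ℝ) + h = 0 := by exact_mod_cast h0
      rw [this] at hηn; linarith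
    · exact h0
  have hn' : (0 : ℝ) < (m : ℝ) + h := by exact_mod_cast hn0
  set v := ⌊η * ((m : ℝ) + h)⌋₊
  have hv1 : 1 ≤ v := Nat.le_floor (by simpa using hηn)
  have hvle : (v : ℝ) ≤ η * ((m : ℝ) + h) := Nat.floor_le (by linarith)
  have hvn : 2 * v ≤ m + h := by
    have : 2 * (v : ℝ) ≤ (m : ℝ) + h := by nlinarith
    exact_mod_cast this
  set y := x / ((m : ℝ) + h + 1)
  have hy : 0 ≤ y := by positivity
  have hv1' : (1 : ℝ) ≤ v := by exact_mod_cast hv1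
  have hexp : Real.exp (-(y ^ 2 / (16 * v))) ≤
      Real.exp (-(y ^ 2 / (16 * (η * ((m : ℝ) + h))))) := by
    rw [Real.exp_le_exp, neg_le_neg_iff]
    gcongr
  have hsub : ((bridges m h).filter fun b => EndMax η b ∧ (m : ℝ) * h / 2 + x ≤ pairArea b) ⊆
      ((bridges m h).filter fun b => ∃ k ≤ v, k * (m / ((m : ℝ) + h)) + y ≤ rights b k) ∪
      ((bridges m h).filter fun b => ∃ k ≤ m + h, m + h ≤ k + v ∧
        k * (m / ((m : ℝ) + h)) + y ≤ rights b k) := by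
    intro b hb
    rw [Finset.mem_filter] at hb
    obtain ⟨hb, he, hx⟩ := hb
    obtain ⟨k, hk, hend, hex⟩ := he.exists_excess hb hn0 hx
    rw [Finset.mem_union, Finset.mem_filter, Finset.mem_filter]
    rcases hend with hend | hend
    · exact Or.inl ⟨hb, k, Nat.le_floor hend, hex⟩
    · refine Or.inr ⟨hb, k, hk, ?_, hex⟩
      have : m + h - k ≤ v := Nat.le_floor (by rw [Nat.cast_sub hk]; push_cast; linarith)
      omega
  have h1 := (Finset.card_le_card hsub).trans (Finset.card_union_le _ _)
  have h2 := card_left_excess_le (m := m) (h := h) hv1 hvn hy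
  have h3 := card_right_excess_le (m := m) (h := h) hv1 hvn hy
  refine (Nat.cast_le.2 h1).trans ?_
  rw [Nat.cast_add]
  have h4 : ((m + h).choose m : ℝ) * Real.exp (-(y ^ 2 / (16 * v))) ≤
      ((m + h).choose m : ℝ) * Real.exp (-(y ^ 2 / (16 * (η * ((m : ℝ) + h))))) := by gcongr
  linarith


/-! ### Lower bound for large areas of bridges -/

theorem reverse_mem_bridges {b : List Bool} {m h : ℕ} :
    b.reverse ∈ bridges m h ↔ b ∈ bridges m h := by
  simp [mem_bridges]

/-- Reversal maps the bridges that fail `P` injectively to bridges that satisfy it, so at least half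
satisfy it. -/
theorem choose_le_two_mul_card_of_reverse {m h : ℕ} (P : List Bool → Prop) [DecidablePred P]
    (hP : ∀ b ∈ bridges m h, ¬ P b → P b.reverse) :
    (m + h).choose m ≤ 2 * ((bridges m h).filter P).card := by
  rw [← card_bridges, ← Finset.card_filter_add_card_filter_not (s := bridges m h) P, two_mul]
  refine Nat.add_le_add_left (Finset.card_le_card_of_injOn List.reverse ?_
    List.reverse_injective.injOn) _
  intro b hb
  simp only [Finset.coe_filter, Set.mem_ofPred_eq] at hb ⊢
  exact ⟨reverse_mem_bridges.2 hb.1, hP b hb.1 hb.2⟩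

theorem choose_le_two_mul_card_area (m h : ℕ) :
    (m + h).choose m ≤ 2 * ((bridges m h).filter fun b => m * h ≤ 2 * pairArea b).card := by
  refine choose_le_two_mul_card_of_reverse _ fun b hb hP => ?_
  have := pairArea_reverse b
  rw [(mem_bridges.1 hb).1, (mem_bridges.1 hb).2] at this
  omega

theorem choose_le_two_mul_card_rights {m h N : ℕ} (hN : m + h = 2 * N) :
    (m + h).choose m ≤ 2 * ((bridges m h).filter fun b => m ≤ 2 * rights b N).card := by
  refine choose_le_two_mul_card_of_reverse _ fun b hb hP => ?_
  have h1 : rights b.reverse N = (b.drop N).count true := by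
    rw [rights, List.take_reverse, List.count_reverse, length_of_mem_bridges hb,
      show m + h - N = N by omega]
  have h2 := rights_add_count_drop b N
  rw [(mem_bridges.1 hb).1] at h2
  omega

theorem card_rights_eq_le {m h N : ℕ} (hN : m + h = 2 * N) (j : ℕ) :
    ((bridges m h).filter fun b => rights b N = j).card ≤ N.choose j * N.choose (m - j) := by
  by_cases hj : j ≤ N ∧ j ≤ m ∧ m - j ≤ N
  · obtain ⟨h1, h2, h3⟩ := hj
    have hc : (bridges j (N - j) ×ˢ bridges (m - j) (N - (m - j))).card =
        N.choose j * N.choose (m - j) := by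
      rw [Finset.card_product, card_bridges, card_bridges, Nat.add_sub_cancel' h1,
        Nat.add_sub_cancel' h3]
    rw [← hc]
    refine Finset.card_le_card_of_injOn (fun b => (b.take N, b.drop N)) ?_ ?_
    · intro b hb
      simp only [Finset.coe_filter, Set.mem_ofPred_eq] at hb
      obtain ⟨hb, hr⟩ := hb
      have hlen := length_of_mem_bridges hb
      have e1 := count_false_take b (k := N) (by omega)
      have e2 := rights_add_count_drop b N
      have e3 := count_true_add_count_false (b.drop N)
      rw [List.length_drop] at e3
      rw [(mem_bridges.1 hb).1] at e2
      simp only [Finset.coe_product, Set.mem_prod, Finset.mem_coe, mem_bridges]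
      refine ⟨⟨hr, ?_⟩, ?_, ?_⟩ <;> omega
    · intro b _ b' _ hbb
      simp only [Prod.mk.injEq] at hbb
      rw [← List.take_append_drop N b, ← List.take_append_drop N b', hbb.1, hbb.2]
  · rw [Finset.filter_eq_empty_iff.2]
    · simp
    · intro b hb hr
      have hlen := length_of_mem_bridges hb
      have e1 := count_false_take b (k := N) (by omega)
      have e2 := rights_add_count_drop b N
      have e3 := count_true_add_count_false (b.drop N)
      rw [List.length_drop] at e3
      rw [(mem_bridges.1 hb).1] at e2
      omega

/-- Two half bridges, each with at least half the area of its own rectangle, are concatenated; this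
keeps at least a quarter of all pairs. Passing through `j` at half time adds a triangle, which
brings the area to at least m h/2 + N(2j - m)/2. -/
theorem le_four_mul_card {m h N : ℕ} (hN : m + h = 2 * N) {j : ℕ} (h1 : j ≤ N) (h2 : j ≤ m)
    (h3 : m - j ≤ N) :
    N.choose j * N.choose (m - j) ≤ 4 * ((bridges m h).filter fun b =>
      rights b N = j ∧ m * h + N * (2 * j) ≤ 2 * pairArea b + N * m).card := by
  have u1 := choose_le_two_mul_card_area j (N - j)
  have u2 := choose_le_two_mul_card_area (m - j) (N - (m - j))
  rw [Nat.add_sub_cancel' h1] at u1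
  rw [Nat.add_sub_cancel' h3] at u2
  refine (Nat.mul_le_mul u1 u2).trans ?_
  rw [show ∀ a b : ℕ, 2 * a * (2 * b) = 4 * (a * b) by intros; ring, ← Finset.card_product]
  refine Nat.mul_le_mul_left _ (Finset.card_le_card_of_injOn (fun x => x.1 ++ x.2) ?_ ?_)
  · rintro ⟨b₁, b₂⟩ hb
    simp only [Finset.coe_product, Set.mem_prod, Finset.mem_coe, Finset.mem_filter] at hb
    obtain ⟨⟨hb1, ha1⟩, hb2, ha2⟩ := hb
    have l1 := length_of_mem_bridges hb1
    simp only [Finset.coe_filter, Set.mem_ofPred_eq, mem_bridges] at hb1 hb2 ⊢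
    refine ⟨⟨?_, ?_⟩, ?_, ?_⟩
    · rw [List.count_append]; omega
    · rw [List.count_append]; omega
    · rw [rights, List.take_left' (by omega)]; exact hb1.1
    · rw [pairArea_append, hb1.1, hb2.2]
      obtain ⟨p, rfl⟩ := Nat.exists_eq_add_of_le h2
      rw [Nat.add_sub_cancel_left] at *
      obtain ⟨q, rfl⟩ := Nat.exists_eq_add_of_le h1
      obtain ⟨r, hr⟩ := Nat.exists_eq_add_of_le h3
      have hh : h = q + r := by omega
      rw [show j + q - p = r by omega]
      rw [show j + q - p = r by omega] at ha2
      rw [Nat.add_sub_cancel_left] at ha1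
      subst hh
      nlinarith
  · rintro ⟨b₁, b₂⟩ hb ⟨b₁', b₂'⟩ hb' heq
    simp only [Finset.coe_product, Set.mem_prod, Finset.mem_coe, Finset.mem_filter] at hb hb'
    have l1 := length_of_mem_bridges hb.1.1
    have l2 := length_of_mem_bridges hb'.1.1
    exact Prod.ext_iff.2 (List.append_inj heq (l1.trans l2.symm))

/-- In terms of the displacement i = 2j - m, the four factors of the ratio are (m + i + 2)/2, (h + i
+ 2)/2, (m - i)/2 and (h - i)/2. -/
theorem choose_mul_choose_succ {m h N j : ℕ} (hN : m + h = 2 * N) (h1 : j + 1 ≤ N)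
    (h2 : j + 1 ≤ m) (h3 : m - j ≤ N) :
    ((N.choose (j + 1) * N.choose (m - (j + 1)) : ℕ) : ℝ) *
      (((m : ℝ) + (2 * j - m) + 2) * ((h : ℝ) + (2 * j - m) + 2)) =
    ((N.choose j * N.choose (m - j) : ℕ) : ℝ) *
      (((m : ℝ) - (2 * j - m)) * ((h : ℝ) - (2 * j - m))) := by
  have e1 := Nat.choose_succ_right_eq N j
  have e2 := Nat.choose_succ_right_eq N (m - (j + 1))
  rw [show m - (j + 1) + 1 = m - j by omega] at e2
  have e1' : (N.choose (j + 1) : ℝ) * (j + 1) = N.choose j * ((N : ℝ) - j) := by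
    rw [← Nat.cast_sub (by omega)]; exact_mod_cast e1
  have e2' : (N.choose (m - j) : ℝ) * ((m : ℝ) - j) =
      N.choose (m - (j + 1)) * ((N : ℝ) - ((m : ℝ) - (j + 1))) := by
    have h4 : (((m - (j + 1) : ℕ)) : ℝ) = (m : ℝ) - (j + 1) := by
      rw [Nat.cast_sub h2]; push_cast; ring
    rw [← h4, ← Nat.cast_sub (by omega), ← Nat.cast_sub (by omega)]; exact_mod_cast e2
  have hh : (h : ℝ) = 2 * N - m := by
    have : (m : ℝ) + h = 2 * N := by exact_mod_cast hN
    linarith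
  push_cast
  rw [hh]
  calc (N.choose (j + 1) : ℝ) * N.choose (m - (j + 1)) *
        (((m : ℝ) + (2 * j - m) + 2) * ((2 * N - m : ℝ) + (2 * j - m) + 2))
      = 4 * ((N.choose (j + 1) : ℝ) * (j + 1)) *
        (N.choose (m - (j + 1)) * ((N : ℝ) - ((m : ℝ) - (j + 1)))) := by ring
    _ = _ := by rw [e1', ← e2']; ring

theorem choose_mul_choose_shift {m h N j s : ℕ} (hN : m + h = 2 * N) (hj : m ≤ 2 * j) {δ : ℝ}
    (hδ : 0 ≤ δ) (hδ1 : δ ≤ 1 / 2) (hm : 2 * (2 * ((j : ℝ) + s) - m + 1) ≤ δ * m)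
    (hh : 2 * (2 * ((j : ℝ) + s) - m + 1) ≤ δ * h) :
    ((N.choose j * N.choose (m - j) : ℕ) : ℝ) * (1 - δ) ^ (2 * s) ≤
      ((N.choose (j + s) * N.choose (m - (j + s)) : ℕ) : ℝ) := by
  induction s with
  | zero => simp
  | succ s ih =>
    push_cast at hm hh
    have ih' := ih (by linarith) (by linarith)
    have hm0 : (0 : ℝ) ≤ m := Nat.cast_nonneg m
    have hh0 : (0 : ℝ) ≤ h := Nat.cast_nonneg h
    have hj' : (m : ℝ) ≤ 2 * j := by exact_mod_cast hj
    have hs0 : (0 : ℝ) ≤ s := Nat.cast_nonneg s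
    have hδm : δ * m ≤ 1 / 2 * m := by gcongr
    have hδh : δ * h ≤ 1 / 2 * h := by gcongr
    have hN' : (m : ℝ) + h = 2 * N := by exact_mod_cast hN
    have h1 : (j + s) + 1 ≤ N := by
      have : ((j : ℝ) + s) + 1 ≤ N := by linarith
      exact_mod_cast this
    have h2 : (j + s) + 1 ≤ m := by
      have : ((j : ℝ) + s) + 1 ≤ m := by linarith
      exact_mod_cast this
    have key := choose_mul_choose_succ (j := j + s) hN h1 h2 (by omega)
    push_cast only [Nat.cast_add] at key
    set i : ℝ := 2 * ((j : ℝ) + s) - m with hi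
    have hi0 : 0 ≤ i := by rw [hi]; linarith
    rw [show j + (s + 1) = j + s + 1 by ring]
    set A : ℝ := ((N.choose (j + s) * N.choose (m - (j + s)) : ℕ) : ℝ)
    set A' : ℝ := ((N.choose (j + s + 1) * N.choose (m - (j + s + 1)) : ℕ) : ℝ)
    have hA : 0 ≤ A := Nat.cast_nonneg _
    have f1 : (1 - δ) * ((m : ℝ) + i + 2) ≤ m - i := by
      have : 0 ≤ δ * (i + 2) := by positivity
      nlinarith
    have f2 : (1 - δ) * ((h : ℝ) + i + 2) ≤ h - i := by
      have : 0 ≤ δ * (i + 2) := by positivity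
      nlinarith
    have hpos : 0 < ((m : ℝ) + i + 2) * ((h : ℝ) + i + 2) := by positivity
    have f3 : ((1 - δ) * ((m : ℝ) + i + 2)) * ((1 - δ) * ((h : ℝ) + i + 2)) ≤
        (m - i) * (h - i) :=
      mul_le_mul f1 f2 (mul_nonneg (by linarith) (by positivity))
        (le_trans (mul_nonneg (by linarith) (by positivity)) f1)
    have f4 : A * (1 - δ) ^ 2 ≤ A' := by
      have := mul_le_mul_of_nonneg_left f3 hA
      rw [← key] at this
      refine le_of_mul_le_mul_right ?_ hpos
      nlinarith
    calc _ = ((N.choose j * N.choose (m - j) : ℕ) : ℝ) * (1 - δ) ^ (2 * s) * (1 - δ) ^ 2 := by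
          ring
      _ ≤ A * (1 - δ) ^ 2 := by gcongr
      _ ≤ A' := f4

-- A typical midpoint is raised by `s`. This gains area N s and costs a factor (1 - δ)^(2s), which
-- is at least exp(-4 δ s).
open Classical in
theorem le_card_area_of_even {m h N s : ℕ} (hN1 : 1 ≤ N) (hN : m + h = 2 * N) {δ x : ℝ}
    (hδ : 0 ≤ δ) (hδ1 : δ ≤ 1 / 2) (hm : 2 * (12 * √N + 2 * s + 1) ≤ δ * m)
    (hh : 2 * (12 * √N + 2 * s + 1) ≤ δ * h) (hx : x ≤ N * s) :
    1 / 16 * Real.exp (-(4 * δ * s)) * (m + h).choose m ≤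
      ((bridges m h).filter fun b => (m : ℝ) * h / 2 + x ≤ pairArea b).card := by
  have hN1' : (1 : ℝ) ≤ N := by exact_mod_cast hN1
  have hN' : (m : ℝ) + h = 2 * N := by exact_mod_cast hN
  set C : ℝ := ((m + h).choose m : ℝ)
  have hC : 0 ≤ C := Nat.cast_nonneg _
  set J := (Finset.range (m + 1)).filter fun j => m ≤ 2 * j ∧ 2 * (j : ℝ) < m + 12 * √N
  set S := (bridges m h).filter fun b => (m : ℝ) * h / 2 + x ≤ pairArea b
  have hG : C / 4 ≤ ((bridges m h).filter fun b => rights b N ∈ J).card := by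
    have g1 : C ≤ 2 * ((bridges m h).filter fun b => m ≤ 2 * rights b N).card := by
      exact (Nat.cast_le.2 (choose_le_two_mul_card_rights hN)).trans_eq (by push_cast; rfl)
    -- At least half of the bridges have their midpoint at or above m/2. The excess 6√N has
    -- probability at most exp(-9/4) ≤ 1/4, so a quarter of all bridges keep a typical midpoint.
    have g2 := card_left_excess_le (m := m) (h := h) (v := N) hN1 hN.ge (y := 6 * √N)
      (by positivity)
    have g3 : -((6 * √(N : ℝ)) ^ 2 / (16 * N)) = -(9 / 4) := by
      rw [mul_pow, Real.sq_sqrt (by positivity)]; field_simp; norm_num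
    have g4 : Real.exp (-(9 / 4 : ℝ)) ≤ 1 / 4 := by
      rw [Real.exp_neg, one_div]
      gcongr
      have h2 : (2 : ℝ) ≤ Real.exp 1 := by linarith [Real.add_one_le_exp (1 : ℝ)]
      calc (4 : ℝ) = 2 ^ 2 := by norm_num
        _ ≤ Real.exp 1 ^ 2 := by gcongr
        _ = Real.exp 2 := by rw [← Real.exp_nat_mul]; norm_num
        _ ≤ _ := by gcongr; norm_num
    rw [g3] at g2
    have g5 : ((bridges m h).filter fun b => m ≤ 2 * rights b N) ⊆
        ((bridges m h).filter fun b => rights b N ∈ J) ∪ ((bridges m h).filter fun b =>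
          ∃ k ≤ N, k * (m / ((m : ℝ) + h)) + 6 * √N ≤ rights b k) := by
      intro b hb
      rw [Finset.mem_filter] at hb
      obtain ⟨hb, hr⟩ := hb
      by_cases hlt : 2 * (rights b N : ℝ) < m + 12 * √N
      · refine Finset.mem_union_left _ (Finset.mem_filter.2
          ⟨hb, Finset.mem_filter.2 ⟨?_, hr, hlt⟩⟩)
        have := rights_add_count_drop b N
        rw [(mem_bridges.1 hb).1] at this
        rw [Finset.mem_range]; omega
      · refine Finset.mem_union_right _ (Finset.mem_filter.2 ⟨hb, N, le_rfl, ?_⟩)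
        have : (N : ℝ) * (m / ((m : ℝ) + h)) = m / 2 := by rw [hN']; field_simp
        rw [this]; linarith
    have g6 : (((bridges m h).filter fun b => m ≤ 2 * rights b N).card : ℝ) ≤
        ((bridges m h).filter fun b => rights b N ∈ J).card + ((bridges m h).filter fun b =>
          ∃ k ≤ N, k * (m / ((m : ℝ) + h)) + 6 * √N ≤ rights b k).card := by
      exact_mod_cast (Finset.card_le_card g5).trans (Finset.card_union_le _ _)
    have g7 : C * Real.exp (-(9 / 4)) ≤ C * (1 / 4) := by gcongr
    linarith
  have hsum : (((bridges m h).filter fun b => rights b N ∈ J).card : ℝ) ≤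
      ∑ j ∈ J, ((N.choose j * N.choose (m - j) : ℕ) : ℝ) := by
    rw [← Nat.cast_sum, Nat.cast_le]
    rw [Finset.card_eq_sum_card_fiberwise (f := fun b => rights b N) (t := J)
      (fun b hb => by simpa using (Finset.mem_filter.1 hb).2)]
    refine Finset.sum_le_sum fun j _ => le_trans (Finset.card_le_card ?_) (card_rights_eq_le hN j)
    intro b hb
    simp only [Finset.mem_filter] at hb ⊢
    exact ⟨hb.1.1, hb.2⟩
  have hexp : Real.exp (-(4 * δ * s)) ≤ (1 - δ) ^ (2 * s) := by
    have h1 : Real.exp (-(2 * δ)) ≤ 1 - δ := by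
      have h2 : |-(2 * δ)| ≤ 1 := by rw [abs_neg, abs_of_nonneg (by linarith)]; linarith
      rw [Real.exp_neg, inv_le_comm₀ (Real.exp_pos _) (by linarith)]
      have h3 := Real.add_one_le_exp (2 * δ)
      refine le_trans ?_ h3
      rw [inv_le_iff_one_le_mul₀ (by linarith)]
      nlinarith
    calc Real.exp (-(4 * δ * s)) = Real.exp (-(2 * δ)) ^ (2 * s) := by
          rw [← Real.exp_nat_mul]; congr 1; push_cast; ring
      _ ≤ _ := by gcongr
  have hJ : ∀ j ∈ J, Real.exp (-(4 * δ * s)) * ((N.choose j * N.choose (m - j) : ℕ) : ℝ) ≤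
      4 * ((S.filter fun b => rights b N = j + s).card : ℝ) := by
    intro j hj
    obtain ⟨-, hj1, hj2⟩ := Finset.mem_filter.1 hj
    have hj1' : (m : ℝ) ≤ 2 * j := by exact_mod_cast hj1
    have b1 : 2 * (2 * ((j : ℝ) + s) - m + 1) ≤ δ * m := by linarith
    have b2 : 2 * (2 * ((j : ℝ) + s) - m + 1) ≤ δ * h := by linarith
    have hs0 : (0 : ℝ) ≤ s := Nat.cast_nonneg s
    have hδm : δ * m ≤ 1 / 2 * m := by gcongr
    have hδh : δ * h ≤ 1 / 2 * h := by gcongr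
    have c1 : j + s ≤ N := by
      have : (j : ℝ) + s ≤ N := by linarith
      exact_mod_cast this
    have c2 : j + s ≤ m := by
      have : (j : ℝ) + s ≤ m := by linarith
      exact_mod_cast this
    have k1 := choose_mul_choose_shift hN hj1 hδ hδ1 b1 b2
    have k2 := le_four_mul_card hN c1 c2 (by omega)
    have k3 : ((N.choose (j + s) * N.choose (m - (j + s)) : ℕ) : ℝ) ≤
        4 * ((S.filter fun b => rights b N = j + s).card : ℝ) := by
      refine le_trans (Nat.cast_le.2 k2) ?_
      rw [Nat.cast_mul, Nat.cast_ofNat]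
      gcongr 4 * ?_
      refine Nat.cast_le.2 (Finset.card_le_card ?_)
      intro b hb
      simp only [Finset.mem_filter, S] at hb ⊢
      refine ⟨⟨hb.1, ?_⟩, hb.2.1⟩
      have h4 : (m : ℝ) * h + N * (2 * (j + s)) ≤ 2 * pairArea b + N * m := by
        exact_mod_cast hb.2.2
      nlinarith
    calc _ ≤ (1 - δ) ^ (2 * s) * ((N.choose j * N.choose (m - j) : ℕ) : ℝ) := by gcongr
      _ ≤ _ := by rw [mul_comm]; exact k1.trans k3
  have hS : ∑ j ∈ J, ((S.filter fun b => rights b N = j + s).card : ℝ) ≤ S.card := by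
    rw [← Nat.cast_sum, Nat.cast_le, ← Finset.card_biUnion]
    · refine Finset.card_le_card (Finset.biUnion_subset.2 fun j _ => Finset.filter_subset _ _)
    · intro j _ j' _ hjj
      rw [Function.onFun, Finset.disjoint_left]
      intro b hb hb'
      have := (Finset.mem_filter.1 hb).2
      have := (Finset.mem_filter.1 hb').2
      omega
  have hE : 0 < Real.exp (-(4 * δ * s)) := Real.exp_pos _
  calc 1 / 16 * Real.exp (-(4 * δ * s)) * C = 1 / 4 * (Real.exp (-(4 * δ * s)) * (C / 4)) := by
        ring
    _ ≤ 1 / 4 * (Real.exp (-(4 * δ * s)) *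
        ∑ j ∈ J, ((N.choose j * N.choose (m - j) : ℕ) : ℝ)) := by gcongr; exact hG.trans hsum
    _ = 1 / 4 * ∑ j ∈ J,
        Real.exp (-(4 * δ * s)) * ((N.choose j * N.choose (m - j) : ℕ) : ℝ) := by
        rw [Finset.mul_sum]
    _ ≤ 1 / 4 * ∑ j ∈ J, 4 * ((S.filter fun b => rights b N = j + s).card : ℝ) := by
        exact mul_le_mul_of_nonneg_left (Finset.sum_le_sum hJ) (by norm_num)
    _ = ∑ j ∈ J, ((S.filter fun b => rights b N = j + s).card : ℝ) := by
        rw [← Finset.mul_sum]; ring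
    _ ≤ _ := hS


open Classical in
theorem le_card_area_even {κ : ℝ} (hκ : 0 < κ) {m h N : ℕ} (hN : m + h = 2 * N)
    (hNκ : 1600 / κ ^ 2 ≤ N) (hm : κ * (2 * N) ≤ m) (hh : κ * (2 * N) ≤ h) {x : ℝ} (hx : 0 ≤ x)
    (hxN : x ≤ κ / 16 * N ^ 2) :
    1 / 16 * Real.exp (-(96 / κ)) * Real.exp (-(72 / κ * (x ^ 2 / N ^ 3))) * (m + h).choose m ≤
      ((bridges m h).filter fun b => (m : ℝ) * h / 2 + x ≤ pairArea b).card := by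
  have hNpos : (0 : ℝ) < N := lt_of_lt_of_le (by positivity) hNκ
  have hN1 : 1 ≤ N := by exact_mod_cast hNpos
  have hN1' : (1 : ℝ) ≤ N := by exact_mod_cast hN1
  set s := ⌈x / N⌉₊
  have hs1 : x / N ≤ s := Nat.le_ceil _
  have hs2 : (s : ℝ) < x / N + 1 := Nat.ceil_lt_add_one (by positivity)
  have hs0 : (0 : ℝ) ≤ s := Nat.cast_nonneg s
  have hsq : √(N : ℝ) ^ 2 = N := Real.sq_sqrt hNpos.le
  have hsq1 : 1 ≤ √(N : ℝ) := Real.one_le_sqrt.2 hN1'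
  have hsqκ : 40 / κ ≤ √(N : ℝ) := by
    refine Real.le_sqrt_of_sq_le (le_of_eq_of_le ?_ hNκ)
    rw [div_pow]; norm_num
  have hxN' : x / N ≤ κ / 16 * N := by
    rw [div_le_iff₀ hNpos]; nlinarith
  -- With s close to x/N, this `δ` makes 4 δ s at most a constant plus a multiple of x²/N³. The
  -- bound 1600/κ² on N gives κ√N ≥ 40, which yields δ ≤ 1/2.
  set δ : ℝ := (12 * √N + 2 * s + 1) / (κ * N) with hδ
  have hκN : 0 < κ * N := by positivity
  have hδ0 : 0 ≤ δ := by positivity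
  have h40 : 40 ≤ κ * √N := by
    rw [div_le_iff₀ hκ] at hsqκ; linarith
  have hδ1 : δ ≤ 1 / 2 := by
    rw [hδ, div_le_iff₀ hκN]
    have : 40 * √N ≤ κ * N := by
      calc 40 * √(N : ℝ) ≤ κ * √N * √N := by gcongr
        _ = κ * N := by rw [mul_assoc, ← pow_two, hsq]
    linarith
  have hδκ : δ * (κ * (2 * N)) = 2 * (12 * √N + 2 * s + 1) := by
    rw [hδ]; field_simp
  have key := le_card_area_of_even (x := x) hN1 hN hδ0 hδ1
    (by rw [← hδκ]; gcongr) (by rw [← hδκ]; gcongr) (by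
      rw [div_le_iff₀ hNpos] at hs1; linarith)
  refine le_trans ?_ key
  rw [mul_assoc (1 / 16 : ℝ), ← Real.exp_add]
  gcongr
  have h1 : (s : ℝ) ≤ s ^ 2 := by
    have : s ≤ s ^ 2 := Nat.le_self_pow (by norm_num) s
    exact_mod_cast this
  have h2 : (s : ℝ) * (12 * √N + 2 * s + 1) ≤ 9 * s ^ 2 + 6 * N := by
    nlinarith [sq_nonneg ((s : ℝ) - √N)]
  have h3 : (s : ℝ) ^ 2 ≤ 2 * (x / N) ^ 2 + 2 := by
    have : 0 ≤ x / N := by positivity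
    nlinarith [sq_nonneg (x / N - 1)]
  have h4 : 4 * δ * s = 4 / (κ * N) * (s * (12 * √N + 2 * s + 1)) := by
    rw [hδ]; field_simp
  have h5 : 4 * δ * s ≤ 4 / (κ * N) * (18 * (x / N) ^ 2 + 24 * N) := by
    rw [h4]; gcongr; linarith
  have h6 : 4 / (κ * N) * (18 * (x / N) ^ 2 + 24 * N) = 72 / κ * (x ^ 2 / N ^ 3) + 96 / κ := by
    field_simp; ring
  linarith

open Classical in
/-- Gaussian lower bound for the probability of a large area under a uniform bridge. -/
theorem exists_le_card_area {κ : ℝ} (hκ : 0 < κ) : ∃ c₁ C₁ c₂ n₀ : ℝ, 0 < c₁ ∧ 0 < C₁ ∧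
    0 < c₂ ∧ 1 ≤ n₀ ∧ ∀ m h : ℕ, n₀ ≤ (m : ℝ) + h → κ * ((m : ℝ) + h) ≤ m →
      κ * ((m : ℝ) + h) ≤ h → ∀ x : ℝ, 0 ≤ x → x ≤ c₂ * ((m : ℝ) + h) ^ 2 →
      c₁ * Real.exp (-(C₁ * (x ^ 2 / ((m : ℝ) + h) ^ 3))) * (m + h).choose m ≤
        ((bridges m h).filter fun b => (m : ℝ) * h / 2 + x ≤ pairArea b).card := by
  refine ⟨min κ 1 / 16 * Real.exp (-(192 / κ)), 9216 / κ, κ / 512, 12801 / κ ^ 2 + 12801,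
    by positivity, by positivity, by positivity, ?_, ?_⟩
  · have : 0 ≤ 12801 / κ ^ 2 := by positivity
    linarith
  intro m h hn hm hh x hx hxn
  have hκ2 : 0 < 12801 / κ ^ 2 := by positivity
  have hn1 : (12801 : ℝ) ≤ (m : ℝ) + h := by linarith
  have hn2 : 12801 / κ ^ 2 ≤ (m : ℝ) + h := by linarith
  have hnpos : (0 : ℝ) < (m : ℝ) + h := by linarith
  rcases Nat.even_or_odd' (m + h) with ⟨N, hN | hN⟩
  · have hN' : (m : ℝ) + h = 2 * N := by exact_mod_cast hN
    rw [hN'] at hm hh hxn hn1 hn2 ⊢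
    have hNpos : (0 : ℝ) < N := by linarith
    have key := le_card_area_even hκ hN (by
      have : 1600 / κ ^ 2 ≤ 12801 / κ ^ 2 / 2 := by
        rw [div_div, div_le_div_iff₀ (by positivity) (by positivity)]
        nlinarith [sq_nonneg κ]
      linarith) hm hh hx (by nlinarith [mul_pos hκ (pow_pos hNpos 2)])
    refine le_trans ?_ key
    have e1 : 72 / κ * (x ^ 2 / (N : ℝ) ^ 3) ≤ 9216 / κ * (x ^ 2 / (2 * (N : ℝ)) ^ 3) := by
      have : 72 / κ * (x ^ 2 / (N : ℝ) ^ 3) = 576 / κ * (x ^ 2 / (2 * (N : ℝ)) ^ 3) := by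
        field_simp; norm_num; ring
      rw [this]
      gcongr
      norm_num
    have e2 : 96 / κ ≤ 192 / κ := by gcongr; norm_num
    gcongr ?_ / 16 * Real.exp (-?_) * Real.exp (-?_) * _
    · exact min_le_right _ _
  -- An odd length is reduced to an even one by prepending a right step: this adds area `h`, more
  -- than the required h/2, and the binomial coefficients differ by a factor at least `κ`. The slope
  -- bound is relaxed to κ/2.
  · have hN' : (m : ℝ) + h = 2 * N + 1 := by exact_mod_cast hN
    have hmpos : 0 < m := by
      have : (0 : ℝ) < m := lt_of_lt_of_le (by positivity) hm
      exact_mod_cast this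
    obtain ⟨m, rfl⟩ := Nat.exists_eq_succ_of_ne_zero hmpos.ne'
    rw [Nat.succ_eq_add_one] at *
    have hNm : m + h = 2 * N := by omega
    have hn1' : (12800 : ℝ) ≤ 2 * N := by linarith
    have hNpos : (0 : ℝ) < N := by linarith
    have hκ1 : κ ≤ 1 := by
      have : κ * (((m + 1 : ℕ) : ℝ) + h) ≤ 1 * (((m + 1 : ℕ) : ℝ) + h) := by
        have : (0 : ℝ) ≤ h := Nat.cast_nonneg h
        linarith
      exact le_of_mul_le_mul_right this hnpos
    rw [hN'] at hm hh hxn hn2 ⊢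
    have hκN : 2 ≤ κ * (2 * N + 1) := by
      rw [div_le_iff₀ (by positivity)] at hn2
      nlinarith [mul_pos hκ hκ]
    push_cast at hm ⊢
    have key := le_card_area_even (κ := κ / 2) (by positivity) hNm (by
      have : 1600 / (κ / 2) ^ 2 = 6400 / κ ^ 2 := by field_simp; norm_num
      rw [this]
      have h1 : 12801 / κ ^ 2 = 12800 / κ ^ 2 + 1 / κ ^ 2 := by ring
      have h2 : 1 ≤ 1 / κ ^ 2 := by
        rw [le_div_iff₀ (by positivity)]; nlinarith
      have h3 : 12800 / κ ^ 2 = 2 * (6400 / κ ^ 2) := by ring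
      linarith) (by nlinarith) (by nlinarith) hx (by
        have : κ / 512 * (2 * N + 1 : ℝ) ^ 2 ≤ κ / 512 * (4 * N) ^ 2 := by
          gcongr; linarith
        nlinarith)
    have hsub : (((bridges m h).filter fun b => (m : ℝ) * h / 2 + x ≤ pairArea b).card : ℝ) ≤
        ((bridges (m + 1) h).filter fun b =>
          ((m : ℝ) + 1) * h / 2 + x ≤ pairArea b).card := by
      refine Nat.cast_le.2 (Finset.card_le_card_of_injOn (true :: ·) ?_
        List.cons_injective.injOn)
      intro b hb
      simp only [Finset.coe_filter, Set.mem_ofPred_eq, mem_bridges] at hb ⊢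
      obtain ⟨⟨hb1, hb2⟩, hb⟩ := hb
      refine ⟨by simpa [hb1] using hb2, ?_⟩
      rw [pairArea_true_cons, hb2]
      push_cast
      have : (0 : ℝ) ≤ h := Nat.cast_nonneg h
      linarith
    refine le_trans ?_ (key.trans hsub)
    have hchoose : κ * ((m + 1 + h).choose (m + 1) : ℝ) ≤ ((m + h).choose m : ℝ) := by
      have h1 := Nat.add_one_mul_choose_eq (m + h) m
      rw [show m + h + 1 = m + 1 + h by ring] at h1
      have h2 : ((m : ℝ) + 1 + h) * ((m + h).choose m : ℝ) =
          ((m + 1 + h).choose (m + 1) : ℝ) * (m + 1) := by exact_mod_cast h1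
      have h3 : (m : ℝ) + 1 + h = 2 * N + 1 := by
        have : (m : ℝ) + h = 2 * N := by exact_mod_cast hNm
        linarith
      rw [h3] at h2
      have h4 : ((m + 1 + h).choose (m + 1) : ℝ) * (κ * (2 * N + 1)) ≤
          ((m + 1 + h).choose (m + 1) : ℝ) * (m + 1) := by gcongr
      rw [← h2] at h4
      refine le_of_mul_le_mul_left ?_ (show (0 : ℝ) < 2 * N + 1 by positivity)
      linarith
    have hexp1 : 96 / (κ / 2) = 192 / κ := by field_simp; norm_num
    rw [hexp1]
    calc _ ≤ κ / 16 * Real.exp (-(192 / κ)) *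
          Real.exp (-(9216 / κ * (x ^ 2 / (2 * (N : ℝ) + 1) ^ 3))) *
            ((m + 1 + h).choose (m + 1) : ℝ) := by
          gcongr; exact min_le_left _ _
      _ = 1 / 16 * Real.exp (-(192 / κ)) *
          Real.exp (-(9216 / κ * (x ^ 2 / (2 * (N : ℝ) + 1) ^ 3))) *
            (κ * ((m + 1 + h).choose (m + 1) : ℝ)) := by ring
      _ ≤ _ := by
          have e1 : 72 / (κ / 2) * (x ^ 2 / (N : ℝ) ^ 3) ≤
              9216 / κ * (x ^ 2 / (2 * (N : ℝ) + 1) ^ 3) := by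
            calc 72 / (κ / 2) * (x ^ 2 / (N : ℝ) ^ 3) = 9216 / κ * (x ^ 2 / (4 * (N : ℝ)) ^ 3) := by
                  field_simp; norm_num; ring
              _ ≤ _ := by gcongr; linarith
          gcongr 1 / 16 * _ * Real.exp (-?_) * ?_

/-! ### Comparison of the two area tails -/

set_option maxHeartbeats 800000 in
open Classical in
/-- Bridges whose least concave majorant has a facet covering nearly the whole bridge are
dominated by bridges enclosing more area. -/
theorem exists_card_endMax_le {κ : ℝ} (hκ : 0 < κ) : ∃ η C n₀ : ℝ, 0 < η ∧ η ≤ 1 / 4 ∧ 0 < C ∧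
    1 ≤ n₀ ∧ ∀ m h : ℕ, n₀ ≤ (m : ℝ) + h → κ * ((m : ℝ) + h) ≤ m → κ * ((m : ℝ) + h) ≤ h →
      ∀ α : ℝ, (((bridges m h).filter fun b => EndMax η b ∧ α ≤ pairArea b).card : ℝ) ≤
        C * ((bridges m h).filter fun b =>
          α + ((m : ℝ) + h) * √((m : ℝ) + h) ≤ pairArea b).card := by
  obtain ⟨c₁, C₁, c₂, n₀, hc₁, hC₁, hc₂, hn₀, key⟩ := exists_le_card_area hκ
  -- With n + 1 ≤ 2n, the rate of `card_endMax_le` is at least x²/(64 η n³), and 1/(128 C₁) makes it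
  -- beat 2 C₁ x²/n³. This suffices because (x + w)² ≤ 2x² + 2n³ for w = n^(3/2). The bound c₂/4
  -- keeps x + w within c₂ n².
  set η : ℝ := min (1 / 4) (min (1 / (128 * C₁)) (c₂ / 4))
  have hη : 0 < η := by positivity
  have hη1 : η ≤ 1 / 4 := min_le_left _ _
  have hη2 : η ≤ 1 / (128 * C₁) := (min_le_right _ _).trans (min_le_left _ _)
  have hη3 : η ≤ c₂ / 4 := (min_le_right _ _).trans (min_le_right _ _)
  refine ⟨η, 2 * Real.exp (2 * C₁) / c₁, n₀ + 1 / η + 4 / c₂ ^ 2, hη, hη1, by positivity, ?_, ?_⟩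
  · have : 0 ≤ 1 / η + 4 / c₂ ^ 2 := by positivity
    linarith
  intro m h hn hm hh α
  set n : ℝ := (m : ℝ) + h with hndef
  have i1 : 0 < 1 / η := by positivity
  have i2 : 0 < 4 / c₂ ^ 2 := by positivity
  have hn1 : n₀ ≤ n := by linarith
  have hnone : 1 ≤ n := by linarith
  have hnpos : 0 < n := by linarith
  have hηn : 1 ≤ η * n := by
    have : 1 / η ≤ n := by linarith
    rw [div_le_iff₀ hη] at this
    linarith
  have hn4 : 4 / c₂ ^ 2 ≤ n := by linarith
  set w : ℝ := n * √n with hw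
  have hw0 : 0 ≤ w := by positivity
  have hwsq : w ^ 2 = n ^ 3 := by rw [hw, mul_pow, Real.sq_sqrt hnpos.le]; ring
  have hwle : w ≤ c₂ / 2 * n ^ 2 := by
    have h1 : 2 / c₂ ≤ √n := Real.le_sqrt_of_sq_le (by rw [div_pow]; norm_num; exact hn4)
    have h2 : 2 ≤ √n * c₂ := by rwa [div_le_iff₀ hc₂] at h1
    have h3 : √n * √n = n := Real.mul_self_sqrt hnpos.le
    calc w = n * √n * 2 / 2 := by rw [hw]; ring
      _ ≤ n * √n * (√n * c₂) / 2 := by gcongr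
      _ = n * (√n * √n) * c₂ / 2 := by ring
      _ = _ := by rw [h3]; ring
  set c : ℝ := ((m + h).choose m : ℝ)
  have hc : 0 ≤ c := Nat.cast_nonneg _
  have hnn : m + h ≠ 0 := by
    intro h0
    have : n = 0 := by rw [hndef]; exact_mod_cast h0
    linarith
  set x := α - m * h / 2 with hx
  -- For α up to m h/2 the trivial upper bound is enough, since extra area of order n^(3/2) has
  -- probability bounded below.
  rcases le_or_gt x 0 with hx0 | hx0
  · have h1 := key m h hn1 hm hh w hw0 (hwle.trans (by
      have : 0 ≤ c₂ * n ^ 2 := by positivity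
      linarith))
    change c₁ * Real.exp (-(C₁ * (w ^ 2 / n ^ 3))) * c ≤ _ at h1
    rw [hwsq, div_self (by positivity), mul_one] at h1
    have h2 : (((bridges m h).filter fun b => EndMax η b ∧ α ≤ pairArea b).card : ℝ) ≤ c := by
      rw [show c = (bridges m h).card by rw [card_bridges]]
      exact Nat.cast_le.2 (Finset.card_filter_le _ _)
    have h3 : (((bridges m h).filter fun b => (m : ℝ) * h / 2 + w ≤ pairArea b).card : ℝ) ≤
        ((bridges m h).filter fun b => α + w ≤ pairArea b).card := by
      refine Nat.cast_le.2 (Finset.card_le_card (Finset.monotone_filter_right _ ?_))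
      intro b _ hb
      linarith
    refine h2.trans ?_
    calc c ≤ 2 * Real.exp (2 * C₁) / c₁ * (c₁ * Real.exp (-C₁) * c) := by
          have h4 : 1 ≤ 2 * Real.exp (2 * C₁) * Real.exp (-C₁) := by
            rw [mul_assoc, ← Real.exp_add]
            have := Real.one_le_exp (x := 2 * C₁ + -C₁) (by linarith)
            linarith
          have h5 : 2 * Real.exp (2 * C₁) / c₁ * (c₁ * Real.exp (-C₁) * c) =
              (2 * Real.exp (2 * C₁) * Real.exp (-C₁)) * c := by field_simp
          rw [h5]; nlinarith
      _ ≤ _ := by gcongr; exact h1.trans h3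
  · by_cases hne : ((bridges m h).filter fun b => EndMax η b ∧ α ≤ pairArea b) = ∅
    · rw [hne]; simp; positivity
    obtain ⟨b, hb⟩ := Finset.nonempty_iff_ne_empty.2 hne
    rw [Finset.mem_filter] at hb
    have hα : α = m * h / 2 + x := by rw [hx]; ring
    have hxle : x ≤ (n + 1) * (η * n) :=
      hb.2.1.le_of_area hb.1 (Nat.pos_of_ne_zero hnn) (by rw [← hα]; exact hb.2.2)
    have hxle' : x ≤ c₂ / 2 * n ^ 2 := by
      calc x ≤ (n + 1) * (η * n) := hxle
        _ ≤ (n + n) * (c₂ / 4 * n) := by gcongr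
        _ = _ := by ring
    have h1 := key m h hn1 hm hh (x + w) (by positivity) (by
      change x + w ≤ c₂ * n ^ 2
      linarith)
    change c₁ * Real.exp (-(C₁ * ((x + w) ^ 2 / n ^ 3))) * c ≤ _ at h1
    have h2 := card_endMax_le (m := m) (h := h) (by linarith : η ≤ 1 / 2) hηn hx0.le
    change _ ≤ 2 * Real.exp (-((x / (n + 1)) ^ 2 / (16 * (η * n)))) * c at h2
    rw [← hα] at h2
    rw [← add_assoc, ← hα] at h1
    refine h2.trans ?_
    have e1 : C₁ * ((x + w) ^ 2 / n ^ 3) ≤ 2 * C₁ * (x ^ 2 / n ^ 3) + 2 * C₁ := by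
      have hsq : (x + w) ^ 2 ≤ 2 * x ^ 2 + 2 * n ^ 3 := by
        rw [← hwsq]
        have := add_sq_le (a := x) (b := w)
        linarith
      have hn3 : 0 < n ^ 3 := by positivity
      calc C₁ * ((x + w) ^ 2 / n ^ 3) ≤ C₁ * ((2 * x ^ 2 + 2 * n ^ 3) / n ^ 3) := by gcongr
        _ = _ := by field_simp
    have e2 : 2 * C₁ * (x ^ 2 / n ^ 3) ≤ (x / (n + 1)) ^ 2 / (16 * (η * n)) := by
      have hηC : η * (128 * C₁) ≤ 1 := by rwa [le_div_iff₀ (by positivity)] at hη2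
      calc 2 * C₁ * (x ^ 2 / n ^ 3) = η * (128 * C₁) * (x ^ 2 / (64 * η * n ^ 3)) := by
            field_simp; norm_num
        _ ≤ 1 * (x ^ 2 / (64 * η * n ^ 3)) := by gcongr
        _ = (x / (n + n)) ^ 2 / (16 * (η * n)) := by field_simp; norm_num
        _ ≤ _ := by gcongr
    calc 2 * Real.exp (-((x / (n + 1)) ^ 2 / (16 * (η * n)))) * c
        ≤ 2 * Real.exp (2 * C₁ + -(C₁ * ((x + w) ^ 2 / n ^ 3))) * c := by
          gcongr; linarith
      _ = 2 * Real.exp (2 * C₁) / c₁ *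
          (c₁ * Real.exp (-(C₁ * ((x + w) ^ 2 / n ^ 3))) * c) := by
          rw [Real.exp_add]; field_simp
      _ ≤ _ := by gcongr


/-! ### Rearranging a block around the diagonal -/

/-- The steps before the block of `n` steps that starts `A` steps before the diagonal. -/
def blockPrefix (A : ℕ) (s : List Bool) : List Bool := s.take (s.count false - A)

/-- The block of `n` steps that starts `A` steps before the diagonal. -/
def block (A n : ℕ) (s : List Bool) : List Bool := (s.drop (s.count false - A)).take n

/-- The steps after the block of `n` steps that starts `A` steps before the diagonal. -/
def blockSuffix (A n : ℕ) (s : List Bool) : List Bool := s.drop (s.count false - A + n)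

theorem blockPrefix_append (A n : ℕ) (s : List Bool) :
    blockPrefix A s ++ (block A n s ++ blockSuffix A n s) = s := by
  rw [block, blockSuffix, ← List.drop_drop, List.take_append_drop, blockPrefix,
    List.take_append_drop]

/-- The words obtained by rearranging the block. -/
def blockClass (A n : ℕ) (s : List Bool) : Finset (List Bool) :=
  (bridges ((block A n s).count true) ((block A n s).count false)).image
    fun b => blockPrefix A s ++ (b ++ blockSuffix A n s)

theorem self_mem_blockClass (A n : ℕ) (s : List Bool) : s ∈ blockClass A n s :=
  Finset.mem_image.2 ⟨block A n s, mem_bridges.2 ⟨rfl, rfl⟩, blockPrefix_append A n s⟩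

theorem length_eq_of_mem_blockClass {A n : ℕ} {s s' : List Bool} (h : s' ∈ blockClass A n s) :
    s'.length = s.length ∧ s'.count false = s.count false := by
  obtain ⟨b, hb, rfl⟩ := Finset.mem_image.1 h
  have hlen := length_of_mem_bridges hb
  rw [count_true_add_count_false] at hlen
  have hs := blockPrefix_append A n s
  constructor
  · conv_rhs => rw [← hs]
    simp only [List.length_append, hlen]
  · conv_rhs => rw [← hs]
    simp only [List.count_append, (mem_bridges.1 hb).2]

theorem length_blockPrefix (A : ℕ) (s : List Bool) :
    (blockPrefix A s).length = s.count false - A := by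
  have := count_true_add_count_false s
  rw [blockPrefix, List.length_take]; omega

theorem length_block (A n : ℕ) (s : List Bool) :
    (block A n s).length = min n (s.length - (s.count false - A)) := by
  rw [block, List.length_take, List.length_drop]

/-- The position of the block depends only on `s.count false`, which rearranging preserves. Hence
the decomposition is stable and the classes partition the words. If the path ends inside the block,
the suffix is empty. -/
theorem block_of_mem_bridges {A n : ℕ} {s b : List Bool}
    (hb : b ∈ bridges ((block A n s).count true) ((block A n s).count false)) :
    block A n (blockPrefix A s ++ (b ++ blockSuffix A n s)) = b ∧
    blockPrefix A (blockPrefix A s ++ (b ++ blockSuffix A n s)) = blockPrefix A s ∧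
    blockSuffix A n (blockPrefix A s ++ (b ++ blockSuffix A n s)) = blockSuffix A n s := by
  have hm : blockPrefix A s ++ (b ++ blockSuffix A n s) ∈ blockClass A n s :=
    Finset.mem_image_of_mem _ hb
  obtain ⟨-, hd⟩ := length_eq_of_mem_blockClass hm
  have hbn := length_of_mem_bridges hb
  rw [count_true_add_count_false, length_block] at hbn
  have hp := length_blockPrefix A s
  have hsuf : (b ++ blockSuffix A n s).take n = b ∧
      (b ++ blockSuffix A n s).drop n = blockSuffix A n s := by
    rcases le_total n (s.length - (s.count false - A)) with h | h
    · rw [min_eq_left h] at hbn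
      exact ⟨List.take_left' hbn, List.drop_left' hbn⟩
    · rw [min_eq_right h] at hbn
      have : blockSuffix A n s = [] := List.drop_eq_nil_of_le (by omega)
      rw [this, List.append_nil]
      exact ⟨List.take_of_length_le (by omega), List.drop_eq_nil_of_le (by omega)⟩
  refine ⟨?_, ?_, ?_⟩
  · rw [block, hd, List.drop_left' hp, hsuf.1]
  · rw [blockPrefix, hd, List.take_left' hp]
  · rw [blockSuffix, hd, ← List.drop_drop, List.drop_left' hp, hsuf.2]

theorem blockClass_eq {A n : ℕ} {s s' : List Bool} (h : s' ∈ blockClass A n s) :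
    blockClass A n s' = blockClass A n s := by
  obtain ⟨b, hb, rfl⟩ := Finset.mem_image.1 h
  obtain ⟨h1, h2, h3⟩ := block_of_mem_bridges hb
  rw [blockClass, h1, h2, h3, (mem_bridges.1 hb).1, (mem_bridges.1 hb).2, blockClass]

/-- The block is not too steep, and its least concave majorant has a long facet. -/
def longFacetBlock (η κ : ℝ) (A n : ℕ) : Set (List Bool) :=
  -- The end of the path may cut the block short, so a lower bound on its actual length is required.
  {s | n ≤ 2 * (block A n s).length ∧ EndMax η (block A n s) ∧
    κ * (block A n s).length ≤ (block A n s).count true ∧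
    κ * (block A n s).length ≤ (block A n s).count false}

-- All words of a class have the same length, hence the same weight, and their areas are that of the
-- block plus a constant `K`. The comparison of bridges, applied at the level y - K, therefore holds
-- class by class.
open Classical in
theorem mass_longFacetBlock_le {lam : ℝ} (h0 : 0 < lam) {κ η C : ℝ} (hC : 0 < C) {n : ℕ}
    (key : ∀ m h : ℕ, n ≤ 2 * (m + h) → κ * ((m : ℝ) + h) ≤ m → κ * ((m : ℝ) + h) ≤ h →
      ∀ α : ℝ, (((bridges m h).filter fun b => EndMax η b ∧ α ≤ pairArea b).card : ℝ) ≤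
        C * ((bridges m h).filter fun b =>
          α + ((m : ℝ) + h) * √((m : ℝ) + h) ≤ pairArea b).card)
    (A : ℕ) (y : ℝ) :
    mass lam (longFacetBlock η κ A n ∩ areaGe y) ≤
      ENNReal.ofReal C * mass lam (areaGe (y + n / 2 * √(n / 2))) := by
  set E := longFacetBlock η κ A n ∩ areaGe y
  set w : ℝ := n / 2 * √(n / 2)
  set T : List Bool → Finset (List Bool) := fun s =>
    (blockClass A n s).filter fun s' => s' ∈ areaGe (y + w) with hT
  set S : List Bool → Finset (List Bool) := fun s =>
    (blockClass A n s).filter fun s' => s' ∈ E with hS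
  have hcard : ∀ s ∈ E, ((S s).card : ℝ) ≤ C * (T s).card := by
    rintro s ⟨⟨hlen, -, hm, hh⟩, -⟩
    set m := (block A n s).count true
    set h := (block A n s).count false
    have hmh : m + h = (block A n s).length := count_true_add_count_false _
    have hmh' : (m : ℝ) + h = (block A n s).length := by exact_mod_cast hmh
    rw [← hmh] at hlen
    rw [← hmh'] at hm hh
    have hw : w ≤ ((m : ℝ) + h) * √((m : ℝ) + h) := by
      have : (n : ℝ) / 2 ≤ (m : ℝ) + h := by
        have : (n : ℝ) ≤ 2 * ((m : ℝ) + h) := by exact_mod_cast hlen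
        linarith
      simp only [w]; gcongr
    set F : List Bool → List Bool := fun b => blockPrefix A s ++ (b ++ blockSuffix A n s)
    have hF : Function.Injective F := fun b b' hbb =>
      List.append_cancel_right (List.append_cancel_left hbb)
    set K : ℕ := pairArea (blockPrefix A s) + pairArea (blockSuffix A n s) +
      m * (blockSuffix A n s).count false +
      (blockPrefix A s).count true * (h + (blockSuffix A n s).count false)
    have harea : ∀ b ∈ bridges m h, (pairArea (F b) : ℝ) = pairArea b + K := by
      intro b hb
      have : pairArea (F b) = pairArea b + K := by
        simp only [F, pairArea_append, List.count_append, (mem_bridges.1 hb).1,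
          (mem_bridges.1 hb).2, K]
        ring
      exact_mod_cast this
    have e1 : (S s).card ≤
        ((bridges m h).filter fun b => EndMax η b ∧ y - K ≤ pairArea b).card := by
      rw [hS]
      simp only [blockClass]
      rw [Finset.filter_image, Finset.card_image_of_injective _ hF]
      refine Finset.card_le_card fun b hb => ?_
      rw [Finset.mem_filter] at hb ⊢
      obtain ⟨hb, ⟨-, he, -⟩, ha⟩ := hb
      refine ⟨hb, ?_, ?_⟩
      · rwa [(block_of_mem_bridges hb).1] at he
      · have h1 : y ≤ pairArea (F b) := ha
        rw [harea b hb] at h1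
        linarith
    have e2 : ((bridges m h).filter fun b =>
        y - K + ((m : ℝ) + h) * √((m : ℝ) + h) ≤ pairArea b).card ≤ (T s).card := by
      rw [hT]
      simp only [blockClass]
      rw [Finset.filter_image, Finset.card_image_of_injective _ hF]
      refine Finset.card_le_card fun b hb => ?_
      rw [Finset.mem_filter] at hb ⊢
      obtain ⟨hb, ha⟩ := hb
      refine ⟨hb, ?_⟩
      change y + w ≤ pairArea (F b)
      rw [harea b hb]
      linarith
    refine (Nat.cast_le.2 e1).trans ((key m h hlen hm hh (y - K)).trans ?_)
    gcongr
  have hvalid : ∀ s s', s ∈ E → s ∈ blockClass A n s' → s' ∈ blockClass A n s ∧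
      blockClass A n s' = blockClass A n s := by
    intro s s' hs hss
    have h3 := blockClass_eq hss
    exact ⟨h3 ▸ self_mem_blockClass A n s', h3.symm⟩
  refine mass_le_of_transport h0 T S hC.le ?_ ?_ ?_
  · intro s hs
    have h1 : 0 < (S s).card :=
      Finset.card_pos.2 ⟨s, Finset.mem_filter.2 ⟨self_mem_blockClass A n s, hs⟩⟩
    have h2 : (0 : ℝ) < (S s).card := by exact_mod_cast h1
    have h3 : (0 : ℝ) < (T s).card := by
      by_contra hcon
      have := hcard s hs
      nlinarith [Nat.cast_nonneg (α := ℝ) (T s).card]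
    exact Finset.card_pos.1 (by exact_mod_cast h3)
  · intro s hs s' hs'
    obtain ⟨h1, h2⟩ := Finset.mem_filter.1 hs'
    have h3 := blockClass_eq h1
    exact ⟨h2, Finset.mem_filter.2 ⟨h3 ▸ self_mem_blockClass A n s, hs⟩⟩
  · intro s' _
    rcases (S s').eq_empty_or_nonempty with hemp | ⟨s₀, hs₀⟩
    · rw [hemp, Finset.sum_empty]; positivity
    · obtain ⟨h1, h2⟩ := Finset.mem_filter.1 hs₀
      obtain ⟨-, h4⟩ := hvalid s₀ s' h2 h1
      have hST : S s' = S s₀ := by simp only [hS, h4]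
      have hall : ∀ s ∈ S s', lam ^ s.length / ((T s).card : ℝ) =
          lam ^ s'.length / (T s₀).card := by
        intro s hs
        obtain ⟨h5, h6⟩ := Finset.mem_filter.1 hs
        obtain ⟨-, h7⟩ := hvalid s s' h6 h5
        rw [(length_eq_of_mem_blockClass h5).1]
        simp only [hT, ← h7, h4]
      rw [Finset.sum_congr rfl hall, Finset.sum_const, nsmul_eq_mul, hST]
      have h8 := hcard s₀ h2
      have h9 : (0 : ℝ) < lam ^ s'.length := by positivity
      rw [mul_div_assoc']
      refine div_le_of_le_mul₀ (Nat.cast_nonneg _) (by positivity) ?_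
      nlinarith


theorem rights_block {A n k : ℕ} (s : List Bool) (hk : k ≤ n) :
    rights s (s.count false - A) + rights (block A n s) k =
      rights s (s.count false - A + k) := by
  rw [block, rights_take _ hk, rights_add]

/-- The block barely exceeds the facet. Either the excess over the block's own chord is largest near
an end, or it is largest below the facet and then some end of the facet does as well. -/
theorem DiagonalChord.mem_longFacetBlock {s : List Bool} {i j A l i₀ : ℕ}
    (hc : DiagonalChord s i j) {η κ : ℝ} (hη : 0 ≤ η) (hκ : 0 ≤ κ)
    (hi₀ : i₀ = s.count false - A)
    (hi : i₀ ≤ i) (hj : j ≤ i₀ + l) (hl : (l : ℝ) ≤ 2 * ((j : ℝ) - i))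
    (hη1 : (i : ℝ) - i₀ ≤ η * ((j : ℝ) - i)) (hη2 : (i₀ : ℝ) + l - j ≤ η * ((j : ℝ) - i))
    (hm : κ * l ≤ (rights s j : ℝ) - rights s i)
    (hh : κ * l ≤ (j : ℝ) - i - (rights s j - rights s i)) :
    s ∈ longFacetBlock η κ A l := by
  subst hi₀
  set i₀ := s.count false - A
  have hjs := hc.le_length
  obtain ⟨p, rfl⟩ := Nat.exists_eq_add_of_le hi
  obtain ⟨q, rfl⟩ := Nat.exists_eq_add_of_le (hi.trans hc.lt.le)
  have hpq : p < q := by have := hc.lt; omega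
  set b := block A l s with hb
  obtain ⟨n, hblen⟩ : ∃ n, b.length = n := ⟨_, rfl⟩
  have hmin := hblen
  rw [hb, length_block] at hmin
  change min l (s.length - i₀) = n at hmin
  have hnl : n ≤ l := by omega
  have hlen : i₀ + n ≤ s.length := by omega
  have hqn : q ≤ n := by omega
  have hnl' : (n : ℝ) ≤ l := by exact_mod_cast hnl
  have hqn' : (q : ℝ) ≤ n := by exact_mod_cast hqn
  push_cast at hη1 hη2 hh hm hl
  have hp0 : (0 : ℝ) ≤ p := Nat.cast_nonneg p
  have hηw : η * ((i₀ : ℝ) + q - (i₀ + p)) ≤ η * n := by gcongr; linarith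
  have hκn : κ * n ≤ κ * l := by gcongr
  have hr : ∀ k ≤ n, (rights s (i₀ + k) : ℝ) = rights s i₀ + rights b k := by
    intro k hk
    have := rights_block (A := A) s (hk.trans hnl)
    exact_mod_cast this.symm
  have hcount : b.count true = rights b n := by rw [← hblen, rights_length]
  have hmono : (rights b p : ℝ) ≤ rights b q := by exact_mod_cast rights_mono b hpq.le
  have h1 : (rights b q : ℝ) ≤ rights b n := by exact_mod_cast rights_mono b hqn
  have h2 : (rights b n : ℝ) ≤ rights b q + (n - q) := by
    have := rights_add_le b q (n - q)
    rw [Nat.add_sub_cancel' hqn] at this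
    rw [← Nat.cast_sub hqn]; exact_mod_cast this
  have h3 : (rights b p : ℝ) ≤ p := by exact_mod_cast rights_le b p
  rw [hr p (by omega), hr q hqn] at hm hh
  have hpq' : (p : ℝ) < q := by exact_mod_cast hpq
  refine ⟨?_, ?_, ?_, ?_⟩
  · rw [← hb, hblen]
    have : (l : ℝ) ≤ 2 * n := by linarith
    exact_mod_cast this
  · rw [EndMax]
    rw [hblen, hcount]
    obtain ⟨k₁, hk₁, hmax⟩ := Finset.exists_max_image (Finset.range (n + 1))
      (fun k => (n : ℝ) * rights b k - k * rights b n) ⟨0, by simp⟩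
    have hmax' : ∀ k ≤ n, (n : ℝ) * rights b k - k * rights b n ≤
        (n : ℝ) * rights b k₁ - k₁ * rights b n :=
      fun k hk => hmax k (by rw [Finset.mem_range]; omega)
    rw [Finset.mem_range] at hk₁
    by_cases hend : (k₁ : ℝ) ≤ η * n ∨ (1 - η) * n ≤ k₁
    · exact ⟨k₁, by omega, hend, hmax'⟩
    · push Not at hend
      have hpk : (p : ℝ) < k₁ := by linarith
      have hkq : (k₁ : ℝ) < q := by linarith
      have hsup := hc.support (i₀ + k₁) (by omega)
      rw [hr p (by omega), hr q hqn, hr k₁ (by omega)] at hsup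
      push_cast at hsup
      set X := (rights b k₁ : ℝ)
      set Xp := (rights b p : ℝ)
      set Xq := (rights b q : ℝ)
      set M := (rights b n : ℝ)
      have hn0 : (0 : ℝ) ≤ n := Nat.cast_nonneg n
      have hsup' : ((q : ℝ) - p) * (X - Xp) ≤ (Xq - Xp) * (k₁ - p) := by linarith
      have hw : (0 : ℝ) < q - p := by linarith
      have hsn := mul_le_mul_of_nonneg_left hsup' hn0
      -- Between `p` and `q` the excess is at most an affine function of time that it equals at both
      -- ends. The sign of its slope decides which end is at least as high as `k₁`.
      rcases le_or_gt ((n : ℝ) * (Xq - Xp)) ((q - p) * M) with hs | hs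
      · refine ⟨p, by omega, Or.inl (by linarith), fun k hk => (hmax' k hk).trans ?_⟩
        refine le_of_mul_le_mul_left ?_ hw
        have := mul_le_mul_of_nonneg_right hs (sub_nonneg.2 hpk.le)
        nlinarith
      · refine ⟨q, by omega, Or.inr (by linarith), fun k hk => (hmax' k hk).trans ?_⟩
        refine le_of_mul_le_mul_left ?_ hw
        have := mul_le_mul_of_nonneg_right hs.le (sub_nonneg.2 hkq.le)
        nlinarith
  · rw [← hb, hcount, hblen]
    linarith
  · have h4 := count_true_add_count_false b
    have h5 : (b.count true : ℝ) + b.count false = n := by rw [← hblen]; exact_mod_cast h4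
    rw [← hb, hblen]
    rw [hcount] at h5
    linarith

/-! ### Flat initial pieces -/

/-- The left side is at most (6X/g)^g and the binomial on the right at least (X/(4g))^(2g). The
constant 192 is what gives 6X/g ≤ (lam X/(4g))²/2. -/
theorem choose_add_le_of_thin {lam : ℝ} (h0 : 0 < lam) (h1 : lam ≤ 1) {X g j : ℕ} (hg : 1 ≤ g)
    (hgX : (g : ℝ) ≤ lam ^ 2 / 192 * X) (hj : j ≤ g) :
    ((X + j).choose X : ℝ) * lam ^ j ≤
      (1 / 2) ^ g * (((X / 2 + 2 * g).choose (X / 2) : ℝ) * lam ^ (2 * g)) := by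
  have hg' : (1 : ℝ) ≤ g := by exact_mod_cast hg
  have hgpos : (0 : ℝ) < g := by linarith
  have hlam2 : lam ^ 2 ≤ 1 := pow_le_one₀ h0.le h1
  have hX0 : (0 : ℝ) ≤ X := Nat.cast_nonneg X
  have hgX1 : (g : ℝ) ≤ X := by nlinarith
  have hXpos : (0 : ℝ) < X := by linarith
  have u1 : ((X + j).choose X : ℝ) * lam ^ j ≤ ((X + g).choose g : ℝ) * 1 := by
    have : (X + j).choose X ≤ (X + g).choose g := by
      rw [← Nat.choose_symm_add (a := X) (b := g)]
      exact Nat.choose_le_choose _ (by omega)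
    gcongr
    exact pow_le_one₀ h0.le h1
  have u2 : ((X + g).choose g : ℝ) ≤ (6 * X / g) ^ g := by
    have a1 : ((X + g).choose g : ℝ) ≤ ((X + g : ℕ) : ℝ) ^ g / (g.factorial : ℝ) :=
      Nat.choose_le_pow_div g (X + g)
    have a2 : (g : ℝ) ^ g / g.factorial ≤ Real.exp g := Real.pow_div_factorial_le_exp g hgpos.le g
    have a3 : Real.exp g ≤ 3 ^ g := by
      have : Real.exp g = Real.exp 1 ^ g := by rw [← Real.exp_nat_mul, mul_one]
      rw [this]
      gcongr
      exact Real.exp_one_lt_three.le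
    have a4 : (1 : ℝ) / g.factorial ≤ 3 ^ g / (g : ℝ) ^ g := by
      rw [le_div_iff₀ (by positivity)]
      calc 1 / (g.factorial : ℝ) * (g : ℝ) ^ g = (g : ℝ) ^ g / g.factorial := by ring
        _ ≤ _ := a2.trans a3
    calc ((X + g).choose g : ℝ) ≤ ((X + g : ℕ) : ℝ) ^ g * (1 / (g.factorial : ℝ)) := by
          rw [mul_one_div]; exact a1
      _ ≤ (2 * X) ^ g * (3 ^ g / (g : ℝ) ^ g) := by
          gcongr
          push_cast; linarith
      _ = _ := by rw [← div_pow, ← mul_pow]; congr 1; ring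
  have u3 : ((X : ℝ) / (4 * g)) ^ (2 * g) ≤ ((X / 2 + 2 * g).choose (X / 2) : ℝ) := by
    rw [Nat.choose_symm_add]
    have b1 : ((X / 2 + 2 * g + 1 - 2 * g : ℕ) : ℝ) ^ (2 * g) / ((2 * g).factorial : ℝ) ≤
        ((X / 2 + 2 * g).choose (2 * g) : ℝ) := Nat.pow_le_choose (2 * g) (X / 2 + 2 * g)
    have b2 : ((2 * g).factorial : ℝ) ≤ (2 * g) ^ (2 * g) := by
      have := Nat.factorial_le_pow (2 * g)
      exact_mod_cast this
    have b3 : (X : ℝ) / 2 ≤ (X / 2 + 2 * g + 1 - 2 * g : ℕ) := by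
      have : X ≤ 2 * (X / 2 + 2 * g + 1 - 2 * g) := by omega
      have : (X : ℝ) ≤ 2 * ((X / 2 + 2 * g + 1 - 2 * g : ℕ) : ℝ) := by exact_mod_cast this
      linarith
    refine le_trans ?_ b1
    calc ((X : ℝ) / (4 * g)) ^ (2 * g) = (X / 2) ^ (2 * g) / (2 * g) ^ (2 * g) := by
          rw [← div_pow]; congr 1; field_simp; norm_num
      _ ≤ _ := by gcongr
  calc ((X + j).choose X : ℝ) * lam ^ j ≤ (6 * X / g) ^ g := by linarith
    _ ≤ ((1 / 2) * (((X : ℝ) / (4 * g)) ^ 2 * lam ^ 2)) ^ g := by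
        gcongr
        rw [div_le_iff₀ hgpos]
        have e : 1 / 2 * (((X : ℝ) / (4 * g)) ^ 2 * lam ^ 2) * g =
            6 * X * (lam ^ 2 / 192 * X / g) := by field_simp; norm_num
        rw [e]
        have : 1 ≤ lam ^ 2 / 192 * X / g := by rwa [le_div_iff₀ hgpos, one_mul]
        nlinarith
    _ = (1 / 2) ^ g * (((X : ℝ) / (4 * g)) ^ (2 * g) * lam ^ (2 * g)) := by
        rw [mul_pow, mul_pow, pow_mul, pow_mul]
    _ ≤ _ := by gcongr

/-- The prefix is replaced by X - X/2 right steps followed by any bridge with X/2 right and 2g down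
steps. The number of right steps is unchanged, so the rest of the path keeps its area, and the
leading right steps alone give area at least X j, the most the old prefix could have. -/
theorem mass_prefix_le {lam : ℝ} (h0 : 0 < lam) (h1 : lam ≤ 1) {X g j : ℕ} (hg : 1 ≤ g)
    (hgX : (g : ℝ) ≤ lam ^ 2 / 192 * X) (hj : j ≤ g) (y : ℝ) :
    mass lam ({s | s.take (X + j) ∈ bridges X j} ∩ areaGe y) ≤
      ENNReal.ofReal ((1 / 2) ^ g) * mass lam (areaGe y) := by
  classical
  set R : List Bool := List.replicate (X - X / 2) true
  set Fam : Finset (List Bool) := (bridges (X / 2) (2 * g)).image (R ++ ·) with hFam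
  have hFcard : Fam.card = (X / 2 + 2 * g).choose (X / 2) := by
    rw [hFam, Finset.card_image_of_injective _ (List.append_right_injective R), card_bridges]
  have hFlen : ∀ p ∈ Fam, p.length = X + 2 * g := by
    intro p hp
    obtain ⟨b, hb, rfl⟩ := Finset.mem_image.1 hp
    rw [List.length_append, length_of_mem_bridges hb, List.length_replicate]; omega
  have hFpos : (0 : ℝ) < Fam.card := by
    rw [hFcard]; exact_mod_cast Nat.choose_pos (by omega)
  refine mass_le_of_transport h0 (fun s => Fam.image (· ++ s.drop (X + j)))
    (fun s' => if X + 2 * g ≤ s'.length then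
      (bridges X j).image (· ++ s'.drop (X + 2 * g)) else ∅) (by positivity) ?_ ?_ ?_
  · intro s _
    exact (Finset.card_pos.1 (by exact_mod_cast hFpos)).image _
  · rintro s ⟨hs, hy⟩ s' hs'
    obtain ⟨p', hp', rfl⟩ := Finset.mem_image.1 hs'
    have hlen := hFlen p' hp'
    refine ⟨?_, ?_⟩
    · have hy' : y ≤ pairArea s := hy
      refine hy'.trans (Nat.cast_le.2 ?_)
      obtain ⟨b, hb, rfl⟩ := Finset.mem_image.1 hp'
      have hs' : s.take (X + j) ∈ bridges X j := hs
      have e0 := List.take_append_drop (X + j) s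
      rw [mem_bridges] at hb hs'
      have e1 : pairArea (s.take (X + j)) ≤ X * j := by
        have := pairArea_le (s.take (X + j))
        rwa [hs'.1, hs'.2] at this
      have e5 : pairArea s = pairArea (s.take (X + j)) + pairArea (s.drop (X + j)) +
          X * (s.drop (X + j)).count false := by
        conv_lhs => rw [← e0, pairArea_append, hs'.1]
      rw [e5]
      simp only [pairArea_append, R, List.count_append, List.count_replicate_self, hb.1, hb.2]
      have e2 : (X - X / 2) + X / 2 = X := by omega
      rw [e2]
      have e3 : X * j ≤ (X - X / 2) * (2 * g) := by
        calc X * j ≤ (2 * (X - X / 2)) * g := Nat.mul_le_mul (by omega) hj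
          _ = _ := by ring
      omega
    · rw [if_pos (by rw [List.length_append]; omega)]
      refine Finset.mem_image.2 ⟨s.take (X + j), hs, ?_⟩
      simp only [List.drop_left' hlen, List.take_append_drop]
  · intro s' _
    split_ifs with hlen
    · set q := s'.drop (X + 2 * g) with hq
      have hs'len : s'.length = X + 2 * g + q.length := by
        rw [hq, List.length_drop]; omega
      have hall : ∀ s ∈ (bridges X j).image (· ++ q),
          lam ^ s.length / ((Fam.image (· ++ s.drop (X + j))).card : ℝ) =
            lam ^ (X + j + q.length) / Fam.card := by
        intro s hs
        obtain ⟨p, hp, rfl⟩ := Finset.mem_image.1 hs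
        have := length_of_mem_bridges hp
        rw [Finset.card_image_of_injective _ (List.append_left_injective _), List.length_append,
          this]
      rw [Finset.sum_congr rfl hall, Finset.sum_const, nsmul_eq_mul,
        Finset.card_image_of_injective _ (List.append_left_injective _), card_bridges, hs'len,
        hFcard]
      have key := choose_add_le_of_thin h0 h1 hg hgX hj
      rw [← hFcard] at key ⊢
      rw [mul_div_assoc', div_le_iff₀ hFpos]
      have hpow : (0 : ℝ) < lam ^ X * lam ^ q.length := by positivity
      calc ((X + j).choose X : ℝ) * lam ^ (X + j + q.length)
          = ((X + j).choose X : ℝ) * lam ^ j * (lam ^ X * lam ^ q.length) := by ring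
        _ ≤ (1 / 2) ^ g * (Fam.card * lam ^ (2 * g)) * (lam ^ X * lam ^ q.length) := by gcongr
        _ = _ := by ring
    · simp only [Finset.sum_empty]; positivity

/-- The words of length at most `L` with a flat initial piece that has at least `R` right
steps. -/
def thinPrefix (σ R : ℝ) (L : ℕ) : Set (List Bool) :=
  {s | s.length ≤ L ∧ ∃ k ≤ s.length, R ≤ rights s k ∧ (k : ℝ) - rights s k ≤ σ * rights s k}

theorem mass_thinPrefix_le {lam : ℝ} (h0 : 0 < lam) (h1 : lam ≤ 1) {σ R : ℝ}
    (hσ : σ = lam ^ 2 / 192) (hR : 1 ≤ σ * R) (L : ℕ) (y : ℝ) :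
    mass lam (thinPrefix σ R L ∩ areaGe y) ≤
      ENNReal.ofReal (2 * ((L : ℝ) + 1) ^ 2 * Real.exp (-(Real.log 2 * (σ * R)))) *
        mass lam (areaGe y) := by
  classical
  have hσpos : 0 < σ := by rw [hσ]; positivity
  set I := (Finset.range (L + 1) ×ˢ Finset.range (L + 1)).filter fun x =>
    R ≤ (x.1 : ℝ) ∧ (x.2 : ℝ) ≤ σ * x.1
  have hsub : thinPrefix σ R L ∩ areaGe y ⊆
      ⋃ x ∈ I, ({s | s.take (x.1 + x.2) ∈ bridges x.1 x.2} ∩ areaGe y) := by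
    rintro s ⟨⟨hL, k, hk, hRk, hσk⟩, hy⟩
    have h2 := count_false_take s hk
    have h3 : (rights s k : ℝ) + (s.take k).count false = k := by exact_mod_cast h2
    simp only [Set.mem_iUnion]
    refine ⟨(rights s k, (s.take k).count false), ?_, ?_, hy⟩
    · simp only [I, Finset.mem_filter, Finset.mem_product, Finset.mem_range]
      exact ⟨⟨by omega, by omega⟩, hRk, by linarith⟩
    · simp only [Set.mem_ofPred_eq]
      rw [h2, mem_bridges]
      exact ⟨rfl, rfl⟩
  have hbound : ∀ x ∈ I, mass lam ({s | s.take (x.1 + x.2) ∈ bridges x.1 x.2} ∩ areaGe y) ≤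
      ENNReal.ofReal (2 * Real.exp (-(Real.log 2 * (σ * R)))) * mass lam (areaGe y) := by
    rintro ⟨X, j⟩ hx
    simp only [I, Finset.mem_filter] at hx
    obtain ⟨-, hRX, hj⟩ := hx
    have hRX' : σ * R ≤ σ * X := by gcongr
    have hg := Nat.floor_le (a := σ * X) (by linarith)
    refine (mass_prefix_le h0 h1 (g := ⌊σ * X⌋₊) (Nat.le_floor (by simpa using hR.trans hRX'))
      (by rw [← hσ]; exact hg) (Nat.le_floor hj) y).trans ?_
    gcongr
    have h4 := Nat.lt_floor_add_one (σ * X)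
    have h5 : ((1 : ℝ) / 2) ^ ⌊σ * X⌋₊ = Real.exp (-(Real.log 2 * ⌊σ * X⌋₊)) := by
      rw [Real.exp_neg, mul_comm (Real.log 2), Real.exp_nat_mul, Real.exp_log two_pos, one_div, inv_pow]
    have h6 : (2 : ℝ) = Real.exp (Real.log 2) := (Real.exp_log two_pos).symm
    rw [h5]
    nth_rewrite 2 [h6]
    rw [← Real.exp_add, Real.exp_le_exp]
    have h7 : 0 < Real.log 2 := Real.log_pos (by norm_num)
    nlinarith
  refine (mass_mono _ hsub).trans ((mass_biUnion_le _ _ _).trans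
    ((Finset.sum_le_sum hbound).trans ?_))
  rw [Finset.sum_const, nsmul_eq_mul, ← mul_assoc, ← ENNReal.ofReal_natCast,
    ← ENNReal.ofReal_mul (Nat.cast_nonneg _)]
  gcongr ENNReal.ofReal ?_ * _
  have hI : (I.card : ℝ) ≤ ((L : ℝ) + 1) ^ 2 := by
    have : I.card ≤ (L + 1) ^ 2 := by
      refine (Finset.card_filter_le _ _).trans ?_
      rw [Finset.card_product, Finset.card_range, pow_two]
    exact_mod_cast this
  nlinarith [Real.exp_pos (-(Real.log 2 * (σ * R)))]


/-! ### Excluding flat chords and long paths -/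

theorem DiagonalChord.dual {s : List Bool} {i j : ℕ} (hc : DiagonalChord s i j) :
    DiagonalChord (dual s) (s.length - j) (s.length - i) := by
  obtain ⟨hlt, hlen, hl, hr, hsup⟩ := hc
  have hd := count_true_add_count_false s
  refine ⟨by omega, by rw [length_dual]; omega, by rw [count_false_dual]; omega,
    by rw [count_false_dual]; omega, ?_⟩
  intro k hk
  rw [length_dual] at hk
  have key : ∀ k ≤ s.length, (rights (StepWord.dual s) k : ℝ) =
      k + rights s (s.length - k) - s.count true := by
    intro k hk
    have : (rights (StepWord.dual s) k : ℝ) + s.count true = k + rights s (s.length - k) := by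
      exact_mod_cast rights_dual s hk
    linarith
  rw [key k hk, key (s.length - j) (by omega), key (s.length - i) (by omega),
    Nat.sub_sub_self hlen, Nat.sub_sub_self (by omega : i ≤ s.length), Nat.cast_sub hlen,
    Nat.cast_sub (by omega : i ≤ s.length)]
  have h := hsup (s.length - k) (by omega)
  rw [Nat.cast_sub hk] at h
  nlinarith

/-- The supporting inequality at time 0 says that the path up to `i` is on average at least as flat
as the chord, so the whole piece up to `j` is flat. It reaches past the diagonal, hence has at least
`R` right steps. -/
theorem DiagonalChord.mem_thinPrefix {s : List Bool} {i j L : ℕ} (hc : DiagonalChord s i j)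
    {σ R : ℝ} (hσ : 0 < σ) (hσ1 : σ ≤ 1) (hL : s.length ≤ L) (hR : 2 * R ≤ s.count false)
    (hthin : (j : ℝ) - i - ((rights s j : ℝ) - rights s i) ≤ σ / 2 * ((j : ℝ) - i)) :
    s ∈ thinPrefix σ R L := by
  have hij : (i : ℝ) < j := by exact_mod_cast hc.lt
  have hdj : (s.count false : ℝ) ≤ j := by exact_mod_cast hc.le_right
  have h0 := hc.support 0 (Nat.zero_le _)
  simp only [rights_zero, Nat.cast_zero, zero_sub] at h0
  have hXi : (rights s i : ℝ) ≤ i := by exact_mod_cast rights_le s i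
  set X : ℝ := (rights s j : ℝ)
  set Y : ℝ := (rights s i : ℝ)
  set w : ℝ := (j : ℝ) - i with hw
  set m : ℝ := X - Y with hm
  have hwpos : 0 < w := by linarith
  have hmw : w / 2 ≤ m := by nlinarith
  have hmpos : 0 < m := by linarith
  have hhf : w - m ≤ σ * m := by nlinarith
  have hX0 : 0 ≤ X := Nat.cast_nonneg _
  have h1 : m * ((j : ℝ) - X) ≤ (w - m) * X := by
    have : (j : ℝ) - X = (i - Y) + (w - m) := by rw [hw, hm]; ring
    rw [this]
    have : X = Y + m := by rw [hm]; ring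
    nlinarith
  have h2 : (j : ℝ) - X ≤ σ * X := by
    refine le_of_mul_le_mul_left (h1.trans ?_) hmpos
    nlinarith
  refine ⟨hL, j, hc.le_length, ?_, h2⟩
  nlinarith

/-- The constant comes from (2 lam)^K < lam² / e: the tail of the length then beats the weight
lam^(2N) of the single path around the N by N square. -/
theorem exists_mass_length_le {lam : ℝ} (h0 : 0 < lam) (h1 : lam < 1 / 2) :
    ∃ K : ℕ, 1 ≤ K ∧ ∀ N : ℕ, mass lam {s | K * N ≤ s.length} ≤
      ENNReal.ofReal (1 / (1 - 2 * lam) * Real.exp (-N)) *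
        mass lam (areaGe ((N : ℝ) ^ 2)) := by
  obtain ⟨K, hK⟩ := exists_pow_lt_of_lt_one (x := lam ^ 2 * Real.exp (-1)) (y := 2 * lam)
    (by positivity) (by linarith)
  have hpos : 0 < 1 - 2 * lam := by linarith
  refine ⟨K + 1, by omega, fun N => (mass_length_ge_le h0 h1 _).trans ?_⟩
  refine le_trans ?_ (mul_le_mul_right (le_mass_areaGe N) _)
  rw [← ENNReal.ofReal_mul (by positivity)]
  refine ENNReal.ofReal_le_ofReal ?_
  have h2 : (2 * lam) ^ (K + 1) ≤ lam ^ 2 * Real.exp (-1) := by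
    rw [pow_succ]
    have : 0 < (2 * lam) ^ K := by positivity
    nlinarith
  calc (2 * lam) ^ ((K + 1) * N) / (1 - 2 * lam)
      ≤ (lam ^ 2 * Real.exp (-1)) ^ N / (1 - 2 * lam) := by rw [pow_mul]; gcongr
    _ = _ := by
        rw [mul_pow, ← pow_mul, ← Real.exp_nat_mul, mul_neg_one]; ring

theorem exists_mass_thinPrefix_le {lam : ℝ} (h0 : 0 < lam) (h1 : lam ≤ 1) {K : ℕ} (hK : 1 ≤ K)
    {σ : ℝ} (hσ : σ = lam ^ 2 / 192) : ∃ c C : ℝ, 0 < c ∧ 0 < C ∧ ∀ N : ℕ, 1 ≤ N →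
      mass lam (thinPrefix σ (N / (2 * K)) (K * N) ∩ areaGe ((N : ℝ) ^ 2)) ≤
        ENNReal.ofReal (C * Real.exp (-(c * N))) * mass lam (areaGe ((N : ℝ) ^ 2)) := by
  have hσpos : 0 < σ := by rw [hσ]; positivity
  have hK' : (1 : ℝ) ≤ K := by exact_mod_cast hK
  have hlog : 0 < Real.log 2 := Real.log_pos (by norm_num)
  have hlog1 : Real.log 2 ≤ 1 := by
    have := Real.log_two_lt_d9; linarith
  set c : ℝ := Real.log 2 * σ / (4 * K) with hc
  have hcpos : 0 < c := by positivity
  refine ⟨c, 16 * K ^ 2 / c ^ 2 + Real.exp 1, hcpos, by positivity, ?_⟩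
  intro N hN
  have hN' : (1 : ℝ) ≤ N := by exact_mod_cast hN
  by_cases hσN : 1 ≤ σ * (N / (2 * K))
  · refine (mass_thinPrefix_le h0 h1 hσ hσN (K * N) _).trans ?_
    gcongr ENNReal.ofReal ?_ * _
    have e1 : Real.log 2 * (σ * (N / (2 * K))) = 2 * (c * N) := by rw [hc]; field_simp; norm_num
    rw [e1]
    have e2 : Real.exp (-(2 * (c * N))) = Real.exp (-(c * N)) * Real.exp (-(c * N)) := by
      rw [← Real.exp_add]; congr 1; ring
    rw [e2, ← mul_assoc]
    refine mul_le_mul_of_nonneg_right ?_ (Real.exp_pos _).le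
    have e3 : (c * N) ^ 2 / 2 ≤ Real.exp (c * N) := by
      have := Real.pow_div_factorial_le_exp (c * N) (by positivity) 2
      simpa using this
    have e4 : ((K * N : ℕ) : ℝ) + 1 ≤ 2 * (K * N) := by
      push_cast
      have : (1 : ℝ) ≤ K * N := by nlinarith
      linarith
    have e5 : 2 * (((K * N : ℕ) : ℝ) + 1) ^ 2 ≤ 16 * K ^ 2 / c ^ 2 * Real.exp (c * N) := by
      calc 2 * (((K * N : ℕ) : ℝ) + 1) ^ 2 ≤ 2 * (2 * (K * N)) ^ 2 := by gcongr
        _ = 16 * K ^ 2 / c ^ 2 * ((c * N) ^ 2 / 2) := by field_simp; ring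
        _ ≤ _ := by gcongr
    rw [Real.exp_neg, ← div_eq_mul_inv, div_le_iff₀ (Real.exp_pos _)]
    have := Real.exp_pos 1
    have := Real.exp_pos (c * N)
    nlinarith
  -- For small N one has c N ≤ 1, and the term `Real.exp 1` in the constant makes the bound trivial.
  · refine (mass_mono lam Set.inter_subset_right).trans ?_
    have hcN : c * N ≤ 1 := by
      have e1 : c * N = Real.log 2 / 2 * (σ * (N / (2 * K))) := by rw [hc]; field_simp; norm_num
      rw [e1]
      push Not at hσN
      have : 0 ≤ σ * (N / (2 * K)) := by positivity
      nlinarith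
    have h2 : (1 : ℝ) ≤ (16 * K ^ 2 / c ^ 2 + Real.exp 1) * Real.exp (-(c * N)) := by
      calc (1 : ℝ) = Real.exp 1 * Real.exp (-1) := by rw [← Real.exp_add]; norm_num
        _ ≤ _ := by
          gcongr
          have : 0 ≤ 16 * (K : ℝ) ^ 2 / c ^ 2 := by positivity
          linarith
    calc mass lam (areaGe ((N : ℝ) ^ 2)) = 1 * mass lam (areaGe ((N : ℝ) ^ 2)) := (one_mul _).symm
      _ ≤ _ := by
        gcongr
        exact ENNReal.one_le_ofReal.2 h2

theorem exists_mul_ge {g : ℕ} (hg : 0 < g) (x : ℕ) : ∃ q, x ≤ g * q ∧ g * q < x + g := by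
  refine ⟨(x + g - 1) / g, ?_, ?_⟩
  · have := Nat.lt_mul_div_succ (x + g - 1) hg
    rw [mul_add, mul_one] at this
    omega
  · have := Nat.mul_div_le (x + g - 1) g
    omega

/-! ### Union bound over grid blocks -/

/-- The words with a long chord above the diagonal that is neither flat nor steep. -/
def balancedChord (κ l : ℝ) (L : ℕ) : Set (List Bool) :=
  {s | s.length ≤ L ∧ ∃ i j, DiagonalChord s i j ∧ l ≤ (j : ℝ) - i ∧
    κ * ((j : ℝ) - i) ≤ (rights s j : ℝ) - rights s i ∧
    κ * ((j : ℝ) - i) ≤ (j : ℝ) - i - ((rights s j : ℝ) - rights s i)}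

/-- The ends of the chord are rounded outwards to a grid of mesh `g`, each by less than `g`, and g ≤
η l/4 makes this negligible. Distances are measured from the diagonal, a time that rearranging the
block does not change. -/
theorem exists_longFacetBlock_of_balancedChord {κ η l : ℝ} {L g : ℕ} {s : List Bool}
    (hκ : 0 < κ) (hη : 0 < η) (hη1 : η ≤ 1 / 4) (hg : 0 < g) (hgl : (g : ℝ) ≤ η * l / 4)
    (hs : s ∈ balancedChord κ l L) : ∃ A B : ℕ, A ≤ B ∧ l ≤ (g * B : ℕ) ∧ g * B ≤ 2 * L ∧
      s ∈ longFacetBlock η (κ / 2) (g * A) (g * B) := by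
  obtain ⟨hL, i, j, hc, hl, hm, hh⟩ := hs
  obtain ⟨A, hA1, hA2⟩ := exists_mul_ge hg (s.count false - i)
  obtain ⟨B, hB1, hB2⟩ := exists_mul_ge hg (j - s.count false)
  have hmul : g * (A + B) = g * A + g * B := mul_add _ _ _
  have hij := hc.lt
  have hjl := hc.le_length
  have hid := hc.left_le
  have hdj := hc.le_right
  have hij' : (i : ℝ) < j := by exact_mod_cast hij
  have hw : g * (A + B) ≤ (j - i) + 2 * g := by omega
  have hw' : ((g * (A + B) : ℕ) : ℝ) ≤ ((j : ℝ) - i) + 2 * g := by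
    rw [← Nat.cast_sub hij.le]; exact_mod_cast hw
  have hw2 : j - i ≤ g * (A + B) := by omega
  have hw2' : (j : ℝ) - i ≤ ((g * (A + B) : ℕ) : ℝ) := by
    rw [← Nat.cast_sub hij.le]; exact_mod_cast hw2
  have hηw : η * l ≤ η * ((j : ℝ) - i) := by gcongr
  have hg2 : 2 * (g : ℝ) ≤ η * ((j : ℝ) - i) := by
    have : 0 ≤ η * ((j : ℝ) - i) := mul_nonneg hη.le (by linarith)
    linarith
  have hηw2 : η * ((j : ℝ) - i) ≤ 1 / 4 * ((j : ℝ) - i) :=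
    mul_le_mul_of_nonneg_right hη1 (by linarith)
  have hgB : ((g * (A + B) : ℕ) : ℝ) ≤ 2 * ((j : ℝ) - i) := by linarith
  refine ⟨A, A + B, by omega, hl.trans hw2', ?_, ?_⟩
  · have : ((j : ℝ) - i) ≤ L := by
      have h1 : (j : ℝ) ≤ L := by exact_mod_cast hjl.trans hL
      have h2 : (0 : ℝ) ≤ i := Nat.cast_nonneg i
      linarith
    have : ((g * (A + B) : ℕ) : ℝ) ≤ ((2 * L : ℕ) : ℝ) := by push_cast at hgB ⊢; linarith
    exact_mod_cast this
  · obtain ⟨i₀, hi₀⟩ : ∃ i₀, i₀ = s.count false - g * A := ⟨_, rfl⟩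
    have hκgB : κ / 2 * ((g * (A + B) : ℕ) : ℝ) ≤ κ * ((j : ℝ) - i) := by
      calc κ / 2 * ((g * (A + B) : ℕ) : ℝ) ≤ κ / 2 * (2 * ((j : ℝ) - i)) := by gcongr
        _ = _ := by ring
    refine hc.mem_longFacetBlock hη.le (by positivity) hi₀ (by omega) (by omega) hgB ?_ ?_
      (hκgB.trans hm) (hκgB.trans hh)
    · have h1 : i ≤ i₀ + g := by omega
      have h2 : (i : ℝ) ≤ i₀ + g := by exact_mod_cast h1
      have h3 : (0 : ℝ) ≤ g := Nat.cast_nonneg g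
      linarith
    · have h1 : i₀ + g * (A + B) ≤ j + 2 * g := by omega
      have h2 : (i₀ : ℝ) + ((g * (A + B) : ℕ) : ℝ) ≤ j + 2 * g := by exact_mod_cast h1
      linarith

theorem mul_mul_sqrt_le {b l G B : ℝ} (hb : 0 ≤ b) (hl : 0 ≤ l) (hB : 1 ≤ B)
    (hG : b * l * B ≤ G) : b * √b * B * (l * √l) ≤ G * √G := by
  have h1 : b * l ≤ G := by
    refine le_trans ?_ hG
    exact le_mul_of_one_le_right (by positivity) hB
  have h2 : √b * √l ≤ √G := by
    rw [← Real.sqrt_mul hb]; exact Real.sqrt_le_sqrt h1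
  have hG0 : 0 ≤ G := le_trans (by positivity) h1
  calc b * √b * B * (l * √l) = (b * l * B) * (√b * √l) := by ring
    _ ≤ G * √G := by gcongr

theorem sum_geometric_prod_le {r : ℝ} (hr : 0 ≤ r) (hr1 : r < 1) (I : Finset (ℕ × ℕ)) {M : ℕ}
    (hI : I ⊆ Finset.range M ×ˢ Finset.range M) :
    ∑ x ∈ I, r ^ x.1 * r ^ x.2 ≤ (1 - r)⁻¹ * (1 - r)⁻¹ := by
  have hs : ∑ k ∈ Finset.range M, r ^ k ≤ (1 - r)⁻¹ := by
    rw [← tsum_geometric_of_lt_one hr hr1]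
    exact (summable_geometric_of_lt_one hr hr1).sum_le_tsum _ fun _ _ => by positivity
  have hs0 : 0 ≤ ∑ k ∈ Finset.range M, r ^ k := Finset.sum_nonneg fun _ _ => by positivity
  calc ∑ x ∈ I, r ^ x.1 * r ^ x.2
      ≤ ∑ x ∈ Finset.range M ×ˢ Finset.range M, r ^ x.1 * r ^ x.2 :=
        Finset.sum_le_sum_of_subset_of_nonneg hI fun _ _ _ => by positivity
    _ = (∑ k ∈ Finset.range M, r ^ k) * ∑ k ∈ Finset.range M, r ^ k := by
        rw [Finset.sum_product, Finset.sum_mul_sum]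
    _ ≤ _ := by gcongr

theorem exists_mass_balancedChord_le {lam : ℝ} (h0 : 0 < lam) (h1 : lam < 1 / 2) {κ : ℝ}
    (hκ : 0 < κ) {K : ℕ} (hK : 1 ≤ K) : ∃ l₀ c C : ℝ, 0 < c ∧ 0 < C ∧ ∀ N : ℕ, 1 ≤ N →
      ∀ l u : ℝ, l₀ ≤ l → 1 ≤ u → l * √l = u * N →
        mass lam (balancedChord κ l (K * N) ∩ areaGe ((N : ℝ) ^ 2)) ≤
          ENNReal.ofReal (C * Real.exp (-(c * u))) * mass lam (areaGe ((N : ℝ) ^ 2)) := by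
  classical
  obtain ⟨η, C₃, n₀, hη, hη1, hC₃, hn₀, hblock⟩ := exists_card_endMax_le (κ := κ / 2) (by positivity)
  -- The extra area never exceeds n² ≤ (2 K N)².
  obtain ⟨c₄, C₄, hc₄, hC₄, harea⟩ := exists_mass_areaGe_add_le h0 h1 (a := 4 * (K : ℝ) ^ 2)
    (by positivity)
  set b : ℝ := η / 16
  have hb : 0 < b := by positivity
  set β : ℝ := c₄ * (b * √b) with hβdef
  have hβ : 0 < β := by positivity
  set r : ℝ := Real.exp (-(β / 4)) with hr
  have hr0 : 0 < r := Real.exp_pos _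
  have hr1 : r < 1 := Real.exp_zero ▸ Real.exp_lt_exp.2 (by linarith)
  have hr1' : 0 < 1 - r := by linarith
  refine ⟨8 / η + 2 * n₀, β / 2, C₃ * C₄ * ((1 - r)⁻¹ * (1 - r)⁻¹), by positivity, by positivity,
    ?_⟩
  intro N hN l u hl hu hlu
  have hN' : (1 : ℝ) ≤ N := by exact_mod_cast hN
  have hηinv : 0 < 8 / η := by positivity
  have hlpos : 0 < l := by linarith
  have hηl : 8 ≤ η * l := by
    have : 8 / η ≤ l := by linarith
    rw [div_le_iff₀ hη] at this
    linarith
  set g := ⌊η * l / 4⌋₊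
  have hg1 : (g : ℝ) ≤ η * l / 4 := Nat.floor_le (by positivity)
  have hg2 : η * l / 8 ≤ g := by
    have := Nat.lt_floor_add_one (η * l / 4)
    linarith
  have hg : 0 < g := Nat.floor_pos.2 (by linarith)
  have hg' : (1 : ℝ) ≤ g := by exact_mod_cast hg
  set M := 2 * (K * N) + 1
  set I := (Finset.range M ×ˢ Finset.range M).filter fun x =>
    x.1 ≤ x.2 ∧ l ≤ (g * x.2 : ℕ) ∧ g * x.2 ≤ 2 * (K * N)
  have hsub : balancedChord κ l (K * N) ∩ areaGe ((N : ℝ) ^ 2) ⊆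
      ⋃ x ∈ I, (longFacetBlock η (κ / 2) (g * x.1) (g * x.2) ∩ areaGe ((N : ℝ) ^ 2)) := by
    rintro s ⟨hs, hy⟩
    obtain ⟨A, B, hAB, hlB, hBL, hs'⟩ :=
      exists_longFacetBlock_of_balancedChord hκ hη hη1 hg hg1 hs
    simp only [Set.mem_iUnion]
    refine ⟨(A, B), ?_, hs', hy⟩
    have hBg : B ≤ g * B := Nat.le_mul_of_pos_left B hg
    simp only [I, Finset.mem_filter, Finset.mem_product, Finset.mem_range]
    exact ⟨⟨by omega, by omega⟩, hAB, hlB, hBL⟩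
  have hterm : ∀ x ∈ I,
      mass lam (longFacetBlock η (κ / 2) (g * x.1) (g * x.2) ∩ areaGe ((N : ℝ) ^ 2)) ≤
        ENNReal.ofReal (C₃ * C₄ * Real.exp (-(β / 2 * u)) * (r ^ x.1 * r ^ x.2)) *
          mass lam (areaGe ((N : ℝ) ^ 2)) := by
    rintro ⟨A, B⟩ hx
    simp only [I, Finset.mem_filter] at hx ⊢
    obtain ⟨-, hAB, hlB, hBL⟩ := hx
    have hB : 1 ≤ B := by
      by_contra hB0
      obtain rfl : B = 0 := by omega
      simp at hlB
      linarith
    have hB' : (1 : ℝ) ≤ B := by exact_mod_cast hB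
    have hAB' : (A : ℝ) ≤ B := by exact_mod_cast hAB
    set n := g * B with hn
    have hn' : (n : ℝ) = g * B := by rw [hn]; push_cast; ring
    have hn1 : (1 : ℝ) ≤ n := by rw [hn']; nlinarith
    have hnL : (n : ℝ) ≤ 2 * (K * N) := by exact_mod_cast hBL
    refine (mass_longFacetBlock_le h0 hC₃ (n := n) (fun m h hnm hm hh α =>
      hblock m h ?_ hm hh α) (g * A) ((N : ℝ) ^ 2)).trans ?_
    · have : (n : ℝ) ≤ 2 * ((m : ℝ) + h) := by exact_mod_cast hnm
      linarith
    -- Since n = g B ≥ η l B/8, the gain (n/2)^(3/2) is at least b^(3/2) B^(3/2) l^(3/2); one power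
    -- of `B` is enough for the summation.
    have hgain : b * √b * B * (u * N) ≤ n / 2 * √(n / 2) := by
      rw [← hlu]
      refine mul_mul_sqrt_le hb.le hlpos.le hB' ?_
      rw [hn']
      have : b * l * B = η * l / 8 * B / 2 := by simp only [b]; ring
      rw [this]
      have : η * l / 8 * B ≤ g * B := by gcongr
      linarith
    have hsqrt : √((n : ℝ) / 2) ≤ n := by
      refine Real.sqrt_le_iff.2 ⟨by linarith, ?_⟩
      nlinarith
    have hxle : b * √b * B * (u * N) ≤ 4 * (K : ℝ) ^ 2 * N ^ 2 := by
      calc b * √b * B * (u * N) ≤ n / 2 * √(n / 2) := hgain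
        _ ≤ n / 2 * n := by gcongr
        _ ≤ n * n := by nlinarith
        _ ≤ (2 * (K * N)) * (2 * (K * N)) := by gcongr
        _ = _ := by ring
    have hA := harea N hN (b * √b * B * (u * N)) (by positivity) hxle
    have hmono := mass_mono lam (areaGe_anti (add_le_add_right hgain ((N : ℝ) ^ 2)))
    calc ENNReal.ofReal C₃ * mass lam (areaGe ((N : ℝ) ^ 2 + n / 2 * √(n / 2)))
        ≤ ENNReal.ofReal C₃ * (ENNReal.ofReal (C₄ * Real.exp (-c₄ * (b * √b * B * (u * N) / N))) *
            mass lam (areaGe ((N : ℝ) ^ 2))) := by gcongr; exact hmono.trans hA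
      _ = ENNReal.ofReal (C₃ * (C₄ * Real.exp (-c₄ * (b * √b * B * (u * N) / N)))) *
            mass lam (areaGe ((N : ℝ) ^ 2)) := by
          rw [← mul_assoc, ← ENNReal.ofReal_mul hC₃.le]
      _ ≤ _ := by
          gcongr ENNReal.ofReal ?_ * _
          have key : Real.exp (-c₄ * (b * √b * B * (u * N) / N)) ≤
              Real.exp (-(β / 2 * u)) * (r ^ A * r ^ B) := by
            rw [hr, ← Real.exp_nat_mul, ← Real.exp_nat_mul, ← Real.exp_add, ← Real.exp_add,
              Real.exp_le_exp]
            have e1 : -c₄ * (b * √b * B * (u * N) / N) = -(β * (B * u)) := by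
              rw [hβdef]; field_simp
            rw [e1]
            -- As A ≤ B and 1 ≤ B, u, the exponent B u pays for geometric decay in both indices and
            -- still leaves u/2.
            have e2 : (A : ℝ) / 4 + B / 4 + u / 2 ≤ B * u := by nlinarith
            have e3 := mul_le_mul_of_nonneg_left e2 hβ.le
            linarith
          calc C₃ * (C₄ * Real.exp (-c₄ * (b * √b * B * (u * N) / N)))
              ≤ C₃ * (C₄ * (Real.exp (-(β / 2 * u)) * (r ^ A * r ^ B))) := by gcongr
            _ = _ := by ring
  refine (mass_mono _ hsub).trans ((mass_biUnion_le _ _ _).trans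
    ((Finset.sum_le_sum hterm).trans ?_))
  rw [← Finset.sum_mul, ← ENNReal.ofReal_sum_of_nonneg (fun x _ => by positivity),
    ← Finset.mul_sum]
  gcongr ENNReal.ofReal ?_ * _
  have hsum := sum_geometric_prod_le hr0.le hr1 I (Finset.filter_subset _ _)
  calc C₃ * C₄ * Real.exp (-(β / 2 * u)) * ∑ x ∈ I, r ^ x.1 * r ^ x.2
      ≤ C₃ * C₄ * Real.exp (-(β / 2 * u)) * ((1 - r)⁻¹ * (1 - r)⁻¹) := by gcongr
    _ = _ := by ring

/-! ### All chords across the diagonal -/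

/-- A long chord above the diagonal is unlikely under the conditioned weights. -/
theorem exists_mass_diagonalChord_le {lam : ℝ} (h0 : 0 < lam) (h1 : lam < 1 / 2) :
    ∃ l₀ c C : ℝ, 0 < c ∧ 0 < C ∧ ∀ N : ℕ, 1 ≤ N → ∀ l u : ℝ, l₀ ≤ l → 1 ≤ u → u ≤ N →
      l * √l = u * N →
        mass lam ({s | ∃ i j, DiagonalChord s i j ∧ l ≤ (j : ℝ) - i} ∩ areaGe ((N : ℝ) ^ 2)) ≤
          ENNReal.ofReal (C * Real.exp (-(c * u))) * mass lam (areaGe ((N : ℝ) ^ 2)) := by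
  obtain ⟨K, hK, hlen⟩ := exists_mass_length_le h0 h1
  obtain ⟨σ, hσ⟩ : ∃ σ, σ = lam ^ 2 / 192 := ⟨_, rfl⟩
  have hσpos : 0 < σ := by rw [hσ]; positivity
  have hσ1 : σ ≤ 1 := by rw [hσ]; nlinarith
  obtain ⟨c₁, C₁, hc₁, hC₁, hthin⟩ := exists_mass_thinPrefix_le h0 (by linarith) hK hσ
  obtain ⟨l₀, c₂, C₂, hc₂, hC₂, hbal⟩ :=
    exists_mass_balancedChord_le h0 h1 (κ := σ / 2) (by positivity) hK
  have hpos : 0 < 1 - 2 * lam := by linarith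
  -- The hypothesis u ≤ N turns the errors exp(-N) and exp(-c₁ N) into exp(-c u).
  set c := min 1 (min c₁ c₂)
  have hcpos : 0 < c := by positivity
  have k1 : c ≤ 1 := min_le_left _ _
  have k2 : c ≤ c₁ := (min_le_right _ _).trans (min_le_left _ _)
  have k3 : c ≤ c₂ := (min_le_right _ _).trans (min_le_right _ _)
  refine ⟨l₀, c, 1 / (1 - 2 * lam) + (C₁ + C₁) + C₂, hcpos, by positivity, ?_⟩
  intro N hN l u hl hu huN hlu
  have hN' : (1 : ℝ) ≤ N := by exact_mod_cast hN
  have hK' : (1 : ℝ) ≤ K := by exact_mod_cast hK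
  set f := mass lam (areaGe ((N : ℝ) ^ 2))
  set E₁ := thinPrefix σ (N / (2 * K)) (K * N) ∩ areaGe ((N : ℝ) ^ 2)
  set E₂ := balancedChord (σ / 2) l (K * N) ∩ areaGe ((N : ℝ) ^ 2)
  -- Area at least N² with at most K N right steps needs at least N/K down steps, so a flat initial
  -- piece reaching the diagonal has size of order N.
  have hR : ∀ s : List Bool, s.length ≤ K * N → s ∈ areaGe ((N : ℝ) ^ 2) →
      2 * ((N : ℝ) / (2 * K)) ≤ s.count false := by
    intro s hL hs
    have a1 : ((N : ℝ)) ^ 2 ≤ pairArea s := hs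
    have a2 : (pairArea s : ℝ) ≤ s.count true * s.count false := by
      exact_mod_cast pairArea_le s
    have a3 : (s.count true : ℝ) ≤ K * N := by
      exact_mod_cast List.count_le_length.trans hL
    have a4 : (s.count true : ℝ) * s.count false ≤ K * N * s.count false := by gcongr
    have a5 : (N : ℝ) ≤ K * s.count false := by
      refine le_of_mul_le_mul_left ?_ (by linarith : (0 : ℝ) < N)
      nlinarith
    have a6 : 2 * ((N : ℝ) / (2 * K)) = N / K := by field_simp
    rw [a6, div_le_iff₀ (by linarith)]
    linarith
  have hsub : {s | ∃ i j, DiagonalChord s i j ∧ l ≤ (j : ℝ) - i} ∩ areaGe ((N : ℝ) ^ 2) ⊆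
      {s | K * N ≤ s.length} ∪ (E₁ ∪ {s | dual s ∈ E₁}) ∪ E₂ := by
    rintro s ⟨⟨i, j, hcd, hl⟩, hs⟩
    by_cases hL : s.length ≤ K * N
    swap
    · exact Or.inl (Or.inl (by simp only [Set.mem_ofPred_eq]; omega))
    by_cases hflat : (j : ℝ) - i - ((rights s j : ℝ) - rights s i) ≤ σ / 2 * ((j : ℝ) - i)
    · exact Or.inl (Or.inr (Or.inl ⟨hcd.mem_thinPrefix hσpos hσ1 hL (hR s hL hs) hflat, hs⟩))
    -- A steep chord becomes flat under reflection, which preserves length and area.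
    by_cases hsteep : (rights s j : ℝ) - rights s i ≤ σ / 2 * ((j : ℝ) - i)
    · refine Or.inl (Or.inr (Or.inr ?_))
      have hs' : dual s ∈ areaGe ((N : ℝ) ^ 2) := by
        have : ((N : ℝ)) ^ 2 ≤ pairArea s := hs
        rw [← pairArea_dual] at this
        exact this
      have hL' : (dual s).length ≤ K * N := by rwa [length_dual]
      refine ⟨hcd.dual.mem_thinPrefix hσpos hσ1 hL' (hR _ hL' hs') ?_, hs'⟩
      have hj := hcd.le_length
      have hi : i ≤ s.length := hcd.lt.le.trans hj
      have r1 := rights_dual s (k := s.length - i) (by omega)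
      have r2 := rights_dual s (k := s.length - j) (by omega)
      rw [Nat.sub_sub_self hi] at r1
      rw [Nat.sub_sub_self hj] at r2
      have r1' : (rights (dual s) (s.length - i) : ℝ) + s.count true =
          ((s.length - i : ℕ) : ℝ) + rights s i := by exact_mod_cast r1
      have r2' : (rights (dual s) (s.length - j) : ℝ) + s.count true =
          ((s.length - j : ℕ) : ℝ) + rights s j := by exact_mod_cast r2
      rw [Nat.cast_sub hi] at r1' ⊢
      rw [Nat.cast_sub hj] at r2' ⊢
      linarith
    · exact Or.inr ⟨⟨hL, i, j, hcd, hl, (not_le.1 hsteep).le, (not_le.1 hflat).le⟩, hs⟩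
  have b0 : mass lam {s | K * N ≤ s.length} ≤
      ENNReal.ofReal (1 / (1 - 2 * lam) * Real.exp (-(c * u))) * f := by
    refine (hlen N).trans ?_
    gcongr ENNReal.ofReal (_ * Real.exp (-?_)) * _
    nlinarith
  have b1 : mass lam E₁ ≤ ENNReal.ofReal (C₁ * Real.exp (-(c * u))) * f := by
    refine (hthin N hN).trans ?_
    gcongr
  have b2 : mass lam {s | dual s ∈ E₁} ≤ ENNReal.ofReal (C₁ * Real.exp (-(c * u))) * f := by
    rw [mass_dual]; exact b1
  have b3 : mass lam E₂ ≤ ENNReal.ofReal (C₂ * Real.exp (-(c * u))) * f := by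
    refine (hbal N hN l u hl hu hlu).trans ?_
    gcongr
  calc _ ≤ mass lam ({s | K * N ≤ s.length} ∪ (E₁ ∪ {s | dual s ∈ E₁}) ∪ E₂) :=
        mass_mono lam hsub
    _ ≤ mass lam {s | K * N ≤ s.length} + (mass lam E₁ + mass lam {s | dual s ∈ E₁}) +
        mass lam E₂ := by
        refine (mass_union_le _ _ _).trans ?_
        gcongr
        refine (mass_union_le _ _ _).trans ?_
        gcongr
        exact mass_union_le _ _ _
    _ ≤ ENNReal.ofReal (1 / (1 - 2 * lam) * Real.exp (-(c * u))) * f +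
        (ENNReal.ofReal (C₁ * Real.exp (-(c * u))) * f +
          ENNReal.ofReal (C₁ * Real.exp (-(c * u))) * f) +
        ENNReal.ofReal (C₂ * Real.exp (-(c * u))) * f := by gcongr
    _ = _ := by
        rw [← add_mul, ← add_mul, ← add_mul, ← ENNReal.ofReal_add (by positivity) (by positivity),
          ← ENNReal.ofReal_add (by positivity) (by positivity),
          ← ENNReal.ofReal_add (by positivity) (by positivity)]
        congr 2
        ring


/-! ### Transfer to the conditioned law -/

theorem law_steps_preimage {lam : ℝ} (h1 : lam < 1 / 2) (E : Set (List Bool)) :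
    OrientedPath.law lam {γ | γ.steps ∈ E} = ENNReal.ofReal (1 - 2 * lam) * mass lam E := by
  classical
  let e : OrientedPath ≃ List Bool := ⟨fun γ => γ.steps, fun s => ⟨s⟩, fun _ => rfl, fun _ => rfl⟩
  rw [OrientedPath.law, Measure.sum_apply _ (by trivial), mass, ← ENNReal.tsum_mul_left,
    ← e.tsum_eq]
  refine tsum_congr fun γ => ?_
  rw [Measure.smul_apply, Measure.dirac_apply' _ (by trivial), smul_eq_mul]
  by_cases h : γ.steps ∈ E
  · rw [Set.indicator_of_mem (by exact h), Set.indicator_of_mem (by exact h), Pi.one_apply, mul_one,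
      ← ENNReal.ofReal_mul (by linarith), div_inv_eq_mul, mul_comm]
    rfl
  · rw [Set.indicator_of_notMem (by exact h), Set.indicator_of_notMem (by exact h), mul_zero,
      mul_zero]

theorem areaLaw_real_le {lam : ℝ} (h1 : lam < 1 / 2) {N : ℕ}
    {F : Set OrientedPath} {E : Set (List Bool)} (hF : ∀ γ ∈ F, γ.steps ∈ E) {K : ℝ} (hK : 0 ≤ K)
    (hE : mass lam (E ∩ areaGe ((N : ℝ) ^ 2)) ≤
      ENNReal.ofReal K * mass lam (areaGe ((N : ℝ) ^ 2))) :
    (OrientedPath.areaLaw lam N).real F ≤ K := by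
  refine ENNReal.toReal_le_of_le_ofReal hK ?_
  have hA : {γ : OrientedPath | N ^ 2 ≤ γ.area} =
      {γ : OrientedPath | γ.steps ∈ areaGe ((N : ℝ) ^ 2)} := by
    ext γ
    simp only [areaGe, Set.mem_ofPred_eq, ← area_eq_pairArea]
    exact_mod_cast Iff.rfl
  rw [OrientedPath.areaLaw, cond_apply (by trivial)]
  have hsub : OrientedPath.law lam ({γ | N ^ 2 ≤ γ.area} ∩ F) ≤
      ENNReal.ofReal K * OrientedPath.law lam {γ | N ^ 2 ≤ γ.area} := by
    calc OrientedPath.law lam ({γ | N ^ 2 ≤ γ.area} ∩ F)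
        ≤ OrientedPath.law lam {γ | γ.steps ∈ E ∩ areaGe ((N : ℝ) ^ 2)} := by
          refine measure_mono fun γ hγ => ⟨hF γ hγ.2, ?_⟩
          have := hγ.1
          rw [hA] at this
          exact this
      _ ≤ ENNReal.ofReal (1 - 2 * lam) *
            (ENNReal.ofReal K * mass lam (areaGe ((N : ℝ) ^ 2))) := by
          rw [law_steps_preimage h1]
          gcongr
      _ = _ := by rw [hA, law_steps_preimage h1, mul_left_comm]
  calc _ ≤ (OrientedPath.law lam {γ | N ^ 2 ≤ γ.area})⁻¹ *
        (ENNReal.ofReal K * OrientedPath.law lam {γ | N ^ 2 ≤ γ.area}) := by gcongr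
    _ = ENNReal.ofReal K * ((OrientedPath.law lam {γ | N ^ 2 ≤ γ.area})⁻¹ *
          OrientedPath.law lam {γ | N ^ 2 ≤ γ.area}) := by rw [mul_left_comm]
    _ ≤ ENNReal.ofReal K * 1 := by gcongr; exact ENNReal.inv_mul_le_one _
    _ = _ := mul_one _

end StepWord

theorem proposition3p1 (lam : ℝ) (hlam0 : 0 < lam) (hlam1 : lam < 1 / 2) :
    ∃ c₀ c C : ℝ, 0 < c₀ ∧ 0 < c ∧ 0 < C ∧
      ∀ (N : ℕ) (t : ℝ), c₀ ≤ t → t ≤ (N : ℝ) ^ (2 / 3 : ℝ) →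
        (OrientedPath.areaLaw lam N).real
            {γ | t * (N : ℝ) ^ (2 / 3 : ℝ) ≤ γ.meanFL}
          ≤ C * Real.exp (-c * t ^ (3 / 2 : ℝ)) := by
  obtain ⟨l₀, c, C, hc, hC, hmain⟩ := StepWord.exists_mass_diagonalChord_le hlam0 hlam1
  -- Since N^(2/3) ≥ 1, the bound t ≥ l₀ ensures t N^(2/3) ≥ l₀. The bound t ≥ 1 excludes N = 0, for
  -- which N^(2/3) = 0.
  refine ⟨max l₀ 1, c, C, lt_max_of_lt_right one_pos, hc, hC, fun N t ht htN => ?_⟩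
  have ht1 : 1 ≤ t := (le_max_right _ _).trans ht
  have ht0 : 0 < t := one_pos.trans_le ht1
  have hN : 1 ≤ N := by
    rcases Nat.eq_zero_or_pos N with rfl | h
    · rw [Nat.cast_zero, Real.zero_rpow (by norm_num)] at htN
      linarith
    · exact h
  have hN1 : (1 : ℝ) ≤ N := by exact_mod_cast hN
  have hN0 : (0 : ℝ) < N := one_pos.trans_le hN1
  have hNp : 1 ≤ (N : ℝ) ^ (2 / 3 : ℝ) := Real.one_le_rpow hN1 (by norm_num)
  have hpow : ((N : ℝ) ^ (2 / 3 : ℝ)) ^ (3 / 2 : ℝ) = N := by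
    rw [← Real.rpow_mul hN0.le]; norm_num
  have hl : 0 < t * (N : ℝ) ^ (2 / 3 : ℝ) := by positivity
  -- With l = t N^(2/3) and u = t^(3/2) one has l^(3/2) = u N, and t ≤ N^(2/3) becomes u ≤ N.
  have key := hmain N hN (t * (N : ℝ) ^ (2 / 3 : ℝ)) (t ^ (3 / 2 : ℝ))
    (by
      refine ((le_max_left _ _).trans ht).trans ?_
      exact le_mul_of_one_le_right ht0.le hNp)
    (Real.one_le_rpow ht1 (by norm_num))
    (by
      rw [← hpow]
      exact Real.rpow_le_rpow ht0.le htN (by norm_num))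
    (by
      rw [Real.sqrt_eq_rpow, ← Real.rpow_one_add' hl.le (by norm_num)]
      norm_num
      rw [Real.mul_rpow ht0.le (by positivity), hpow])
  rw [← neg_mul] at key
  exact StepWord.areaLaw_real_le hlam1 (fun γ hγ => StepWord.exists_diagonalChord_of_le_meanFL hl hγ)
    (by positivity) key
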